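/- Let $\mathcal X$ be a finite set of $|r|$ actions and let $r(x) = r_{obs}(x) + r_{hid}(x)$, $x\in\mathcal X$, be a random reward, where $r_{obs}\sim\mathcal N(\mu,\Sigma)$ is a Gaussian vector (with $\Sigma$ positive semidefinite and $\Sigma_{x,x}\le 1$ for all $x$) and $r_{hid}$ is a random vector with finite mean $\mathbb E[r_{hid}]$ that is independent of $r_{obs}$. Let $x^* = \arg\max_x r(x)$ (ties are broken by an arbitrary fixed measurable rule that is a function of the vector $r$). Let $T\ge 0$ and $\sigma>0$. In round $n=1,\dots,T$ an action $x_n$ is chosen and $y_n = r_{obs}(x_n)+\eta_n$ is observed, where the noise is additive and Gaussian, $\eta_n\sim\mathcal N(0,\sigma_n^2)$ with $0<\sigma_n\le\sigma$, and independent of the rewards $(r_{obs}, r_{hid})$ and of the past; more generally the noise level may also depend on the chosen action: $\eta_n=\eta_{n,x_n}$, with the family $(\eta_{n,x})_{x\in\mathcal X}$ independent of $(r_{obs},r_{hid},\mathcal H_{n-1},x_n)$ and $\eta_{n,x}\sim\mathcal N(0,\sigma_{n,x}^2)$, $0<\sigma_{n,x}\le\sigma$. Let $\mathcal H_{n}=(x_i,y_i)_{i=1}^{n}$.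 The actions are chosen by Thompson sampling: $x_n\sim\mathbb P[x^*\mid\mathcal H_{n-1}]$, i.e. $\mathbb P[x_n=a\mid r_{obs},r_{hid},\mathcal H_{n-1}]=\mathbb P[x^*=a\mid\mathcal H_{n-1}]$ for all $a\in\mathcal X$. The oracle action is $x^*_{obs}\sim\mathbb P[x^*\mid r_{obs}]$, i.e. $\mathbb P[x^*_{obs}=a\mid r_{obs},r_{hid}]=\mathbb P[x^*=a\mid r_{obs}]$ for all $a\in\mathcal X$. Let $\gamma_T=\max_{x_{1:T}\in\mathcal X^T} I(r_{obs};y_{1:T})$ be the maximum information gain, where for fixed locations $x_{1:T}$ the mutual information (in nats) is that between $r_{obs}$ and $y_{1:T}=(r_{obs}(x_n)+\eta_n)_{n=1}^T$ with $\eta_1,\dots,\eta_T$ independent of each other and of $r_{obs}$. Then $\gamma_T<\infty$, the cumulative regret below is integrable, and $$\mathbb E\Big[\sum_{n=1}^T \big(r(x^*_{obs}) - r(x_n)\big)\Big]\le \beta\sqrt{C_\sigma\, T\,\gamma_T},\qquad C_\sigma=\frac{2}{\ln(1+\sigma^{-2})},\qquad \beta = 1+\sqrt{2\ln(2|r|)+2}.$$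 -/

import Mathlib

open MeasureTheory ProbabilityTheory InformationTheory
open scoped NNReal ENNReal

noncomputable section

namespace ThompsonHidden

/-- Mutual information (in nats) of the two components of a pair with joint law `ρ`:
the Kullback-Leibler divergence of `ρ` from the product of its marginals. -/
def mutualInformation {α β : Type*} [MeasurableSpace α] [MeasurableSpace β]
    (ρ : Measure (α × β)) : ℝ≥0∞ :=
  klDiv ρ (ρ.fst.prod ρ.snd)

variable {𝒳 : Type*} [Fintype 𝒳] [DecidableEq 𝒳] {T : ℕ}

/-- The joint law of `(r, y)` for `r ∼ N(μ, S)` and `y t = r (l t) + η t` at the fixed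
locations `l`, with independent noise `η t ∼ N(0, (s t (l t))²)`, also independent of `r`. -/
def observationLaw (μ : EuclideanSpace ℝ 𝒳) (S : Matrix 𝒳 𝒳 ℝ) (s : Fin T → 𝒳 → ℝ≥0)
    (l : Fin T → 𝒳) : Measure (EuclideanSpace ℝ 𝒳 × (Fin T → ℝ)) :=
  ((multivariateGaussian μ S).prod
      (Measure.pi fun t : Fin T => gaussianReal 0 (s t (l t) ^ 2))).map
    fun p => (p.1, fun t => p.1 (l t) + p.2 t)

/-- The maximum information gain `γ_T = max_{l} I(r; y_{1:T})` over all `T`-tuples of locations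
(a maximum over a finite set). -/
def maxInfoGain (μ : EuclideanSpace ℝ 𝒳) (S : Matrix 𝒳 𝒳 ℝ) (s : Fin T → 𝒳 → ℝ≥0) : ℝ≥0∞ :=
  ⨆ l : Fin T → 𝒳, mutualInformation (observationLaw μ S s l)

/-- The history available before round `n`: all pairs (action, observation) of earlier rounds. -/
def history {Ω A : Type*} (x : Fin T → Ω → A) (y : Fin T → Ω → ℝ) (n : Fin T) (ω : Ω) :
    Set.Iio n → A × ℝ :=
  fun i => (x i ω, y i ω)

/-- The σ-algebra on `Ω` generated by a random element `X`. -/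
abbrev sigmaOf {Ω α : Type*} [mα : MeasurableSpace α] (X : Ω → α) : MeasurableSpace Ω :=
  mα.comap X

/-- The constant `C_σ = 2 / ln (1 + σ⁻²)`. -/
def noiseConst (σ : ℝ≥0) : ℝ := 2 / Real.log (1 + ((σ : ℝ) ^ 2)⁻¹)

/-- The constant `β = 1 + √(2 ln (2 N) + 2)`, where `N` is the number of actions. -/
def betaConst (N : ℕ) : ℝ := 1 + Real.sqrt (2 * Real.log (2 * N) + 2)

end ThompsonHidden

end

set_option linter.unusedSectionVars false

/-! Write `m` and `k` for the posterior mean and the posterior variances of the observable rewards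
given the history. The history carries no information about the hidden rewards, so each action `a`
contributes the same hidden term, the probability that `a` is optimal times the mean of its hidden
reward, to the value of the oracle and to that of the played action. These terms cancel, and the
expected regret of a round is exactly the mean of the residual `rObs - m` evaluated at the optimal
action (`round_regret_le`).

Given the history, each coordinate of the residual is a centred Gaussian with variance `k a`. For
every `c > 0`, a residual `√k * Z` is at most `(c * k + Z ^ 2 / c) / 2`. The optimal action depends
on the residual, so `Z ^ 2` at that action is controlled by a union bound over all actions:
`sq_le_add_cosh` and the Gaussian exponential moments give mean at most `2 log (2N) + 2`. The
variance at the optimal action has the same mean as the one at the played action, since both actions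
have the same conditional law given the history.

Along any sequence of locations the posterior variances are deterministic, and their sum is at most
`C_σ` times the information gain. This gain is computed in closed form by Kalman filtering: it is
the sum of the terms `log (predictive variance / noise variance) / 2`
(`mutualInformation_observationLaw`, `sum_postCov_le`). Summing the rounds with one common `c` and
then optimizing over `c` plays the role of Cauchy-Schwarz and gives the bound.

The delicate point is that the locations are random and depend on past observations. It is handled
by restricting to the finitely many events on which the past actions are fixed
(`exists_map_residual_actionEvent`). Choosing the next action only reweights the law by a function
of the history, which leaves the residual Gaussian and independent of the hidden rewards and of the
observations; `integral_history_mul_residual` glues these events together. -/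

noncomputable section

namespace ThompsonHidden

open Matrix WithLp

/-! ### Gaussian conditioning on one noisy coordinate. -/

section GaussianStep

variable {𝒳 : Type*} [Fintype 𝒳] [DecidableEq 𝒳]

/-- The variance of the observation `z a + ε` for `z ∼ N(0, K)`, `ε ∼ N(0, v)`. -/
def innovVar (K : Matrix 𝒳 𝒳 ℝ) (v : ℝ≥0) (a : 𝒳) : ℝ≥0 := (K a a).toNNReal + v

/-- The Kalman gain of an observation of coordinate `a` with noise variance `v`. -/
def gain (K : Matrix 𝒳 𝒳 ℝ) (v : ℝ≥0) (a : 𝒳) : EuclideanSpace ℝ 𝒳 :=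
  toLp 2 fun b => K b a / innovVar K v a

/-- The posterior covariance after an observation of coordinate `a` with noise variance `v`. -/
def condCov (K : Matrix 𝒳 𝒳 ℝ) (v : ℝ≥0) (a : 𝒳) : Matrix 𝒳 𝒳 ℝ :=
  Matrix.of fun b c => K b c - K b a * K c a / innovVar K v a

variable {K : Matrix 𝒳 𝒳 ℝ} {v : ℝ≥0} {a : 𝒳}

lemma innovVar_pos (hv : 0 < v) : 0 < innovVar K v a := add_pos_of_nonneg_of_pos zero_le hv

lemma coe_innovVar (hK : K.PosSemidef) : (innovVar K v a : ℝ) = K a a + v := by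
  simp [innovVar, Real.coe_toNNReal _ hK.diag_nonneg]

lemma _root_.Matrix.PosSemidef.apply_comm (hK : K.PosSemidef) (b c : 𝒳) : K b c = K c b := by
  have := hK.isHermitian.apply c b
  simpa using this

lemma dotProduct_mulVec_add_single (hK : K.PosSemidef) (x : 𝒳 → ℝ) (c : ℝ) :
    (x + Pi.single a c) ⬝ᵥ K *ᵥ (x + Pi.single a c)
      = x ⬝ᵥ K *ᵥ x + 2 * c * (∑ b, x b * K b a) + c ^ 2 * K a a := by
  have h1 : K a ⬝ᵥ x = ∑ b, x b * K b a :=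
    Finset.sum_congr rfl fun b _ => by rw [hK.apply_comm a b, mul_comm]
  have h2 : x ⬝ᵥ K *ᵥ Pi.single a c = c * ∑ b, x b * K b a := by
    simp [dotProduct, Finset.mul_sum, mul_comm, mul_left_comm]
  have h3 : Pi.single a c ⬝ᵥ K *ᵥ x = c * ∑ b, x b * K b a := by
    rw [single_dotProduct, ← h1]; rfl
  have h4 : Pi.single a c ⬝ᵥ K *ᵥ Pi.single a c = c ^ 2 * K a a := by
    simp; ring
  rw [mulVec_add, dotProduct_add, add_dotProduct, add_dotProduct, h2, h3, h4]
  ring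

lemma dotProduct_condCov_mulVec (x : 𝒳 → ℝ) :
    x ⬝ᵥ condCov K v a *ᵥ x
      = x ⬝ᵥ K *ᵥ x - (∑ b, x b * K b a) ^ 2 / innovVar K v a := by
  simp only [dotProduct, mulVec, condCov, of_apply, sub_mul, Finset.sum_sub_distrib, mul_sub, sq,
    Finset.sum_mul, Finset.mul_sum, Finset.sum_div]
  congr 1
  exact Finset.sum_congr rfl fun b _ => Finset.sum_congr rfl fun c _ => by ring

/-- Completing the square: with `V` the innovation variance and `p` the covariance of `x` with
coordinate `a`, the new form at `x` is the old form at `x - (p / V) e_a` plus `(p / V) ^ 2 * v`. -/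
lemma posSemidef_condCov (hK : K.PosSemidef) (hv : 0 < v) : (condCov K v a).PosSemidef := by
  refine PosSemidef.of_dotProduct_mulVec_nonneg ?_ fun x => ?_
  · ext b c
    simp [condCov, hK.apply_comm b c, mul_comm]
  · have hV : (0 : ℝ) < innovVar K v a := innovVar_pos hv
    set p := ∑ b, x b * K b a with hp
    have h := hK.dotProduct_mulVec_nonneg (x + Pi.single a (-(p / innovVar K v a)))
    simp only [star_trivial] at h ⊢
    rw [dotProduct_mulVec_add_single hK, ← hp] at h
    rw [dotProduct_condCov_mulVec, ← hp]
    have e := coe_innovVar (v := v) (a := a) hK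
    have e' : K a a = innovVar K v a - v := by linarith
    rw [e'] at h
    have : x ⬝ᵥ K *ᵥ x - p ^ 2 / innovVar K v a =
      x ⬝ᵥ K *ᵥ x + 2 * -(p / innovVar K v a) * p + (-(p / innovVar K v a)) ^ 2 * (innovVar K v a - v)
       + (p / innovVar K v a) ^ 2 * v := by
      field_simp
      ring
    rw [this]
    positivity

lemma condCov_diag_le (b : 𝒳) : condCov K v a b b ≤ K b b := by
  simp only [condCov, of_apply, tsub_le_iff_right, le_add_iff_nonneg_right]
  exact div_nonneg (mul_self_nonneg _) (NNReal.coe_nonneg _)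

/-- One step of Gaussian conditioning: the innovation `W = z a + ε` is independent of the residual
`z - W • gain`, and both are Gaussian. -/
theorem map_innovation (hK : K.PosSemidef) (hv : 0 < v) (a : 𝒳) :
    ((multivariateGaussian 0 K).prod (gaussianReal 0 v)).map
        (fun p => (p.1 - (p.1 a + p.2) • gain K v a, p.1 a + p.2))
      = (multivariateGaussian 0 (condCov K v a)).prod (gaussianReal 0 (innovVar K v a)) := by
  have hm : Measurable fun p : EuclideanSpace ℝ 𝒳 × ℝ =>
      (p.1 - (p.1 a + p.2) • gain K v a, p.1 a + p.2) := by fun_prop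
  have := Measure.isProbabilityMeasure_map (μ := (multivariateGaussian 0 K).prod (gaussianReal 0 v))
    hm.aemeasurable
  refine charFun_eq_prod_iff.1 fun t => ?_
  obtain ⟨t, τ⟩ := t
  set κ : ℝ := (∑ b, t b * K b a) / innovVar K v a with hκ
  have hV : (0 : ℝ) < innovVar K v a := innovVar_pos hv
  -- A linear functional of residual and innovation is one of `(z, ε)`: the frequency `t` moves by
  -- `τ - κ` along coordinate `a`, with `κ` the pairing of the gain with `t`. The cross terms
  -- between `t` and `τ` then cancel in the exponent, which is the claimed independence.
  have hin : ∀ p : EuclideanSpace ℝ 𝒳 × ℝ,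
      inner ℝ (toLp 2 (p.1 - (p.1 a + p.2) • gain K v a, p.1 a + p.2)) (toLp 2 (t, τ))
        = inner ℝ (toLp 2 p) (toLp 2 (toLp 2 (t.ofLp + Pi.single a (τ - κ)), τ - κ)) := by
    intro p
    have : inner ℝ (gain K v a) t = κ := by
      simp [gain, PiLp.inner_apply, hκ, Finset.sum_div, mul_div_assoc]
    have h2 : inner ℝ p.1 (toLp 2 (t.ofLp + Pi.single a (τ - κ))) = inner ℝ p.1 t + (τ - κ) * p.1 a := by
      rw [toLp_add, inner_add_right]
      simp [PiLp.inner_apply]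
    simp only [prod_inner_apply, inner_sub_left, inner_smul_left, this, h2]
    simp
    ring
  have key : charFun ((((multivariateGaussian 0 K).prod (gaussianReal 0 v)).map
        (fun p => (p.1 - (p.1 a + p.2) • gain K v a, p.1 a + p.2))).map (toLp 2)) (toLp 2 (t, τ))
      = charFun (((multivariateGaussian 0 K).prod (gaussianReal 0 v)).map (toLp 2))
          (toLp 2 (toLp 2 (t.ofLp + Pi.single a (τ - κ)), τ - κ)) := by
    rw [Measure.map_map (by fun_prop) hm, charFun_apply, charFun_apply,
      integral_map (by fun_prop) (by fun_prop), integral_map (by fun_prop) (by fun_prop)]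
    simp only [Function.comp_apply, hin]
  refine key.trans ?_
  rw [charFun_prod]
  simp only
  rw [charFun_multivariateGaussian hK, charFun_multivariateGaussian (posSemidef_condCov hK hv),
    charFun_gaussianReal, charFun_gaussianReal, ← Complex.exp_add, ← Complex.exp_add]
  have e1 := dotProduct_mulVec_add_single (a := a) hK t.ofLp (τ - κ)
  have e2 := dotProduct_condCov_mulVec (K := K) (v := v) (a := a) t.ofLp
  have e3 := coe_innovVar (v := v) (a := a) hK
  have e4 : ∑ b, t b * K b a = κ * innovVar K v a := by rw [hκ]; field_simp
  rw [e4] at e1 e2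
  have e5 : K a a = innovVar K v a - v := by linarith
  rw [e5] at e1
  congr 1
  simp only [e1, e2]
  push_cast
  simp only [inner_zero_right, Complex.ofReal_zero, zero_mul, mul_zero]
  have hV' : ((innovVar K v a : ℝ) : ℂ) ≠ 0 := by exact_mod_cast hV.ne'
  field_simp
  ring

end GaussianStep

/-! ### Kalman filtering along fixed locations. -/

section Filtering

variable {𝒳 : Type*} [Fintype 𝒳] [DecidableEq 𝒳] {T : ℕ}

/-- Moves the middle factor outermost, so that it can be frozen while the two outer factors are
transformed jointly. -/
lemma lintegral_prod_prod_swap {α β γ : Type*} [MeasurableSpace α] [MeasurableSpace β]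
    [MeasurableSpace γ] (A : Measure α) (B : Measure β) (C : Measure γ) [SFinite A] [SFinite B]
    [SFinite C] {f : α × β × γ → ℝ≥0∞} (hf : Measurable f) :
    ∫⁻ p, f p ∂(A.prod (B.prod C)) = ∫⁻ b, ∫⁻ q, f (q.1, b, q.2) ∂(A.prod C) ∂B := by
  rw [lintegral_prod _ hf.aemeasurable]
  have h1 : ∀ a, ∫⁻ p, f (a, p) ∂(B.prod C) = ∫⁻ b, ∫⁻ c, f (a, b, c) ∂C ∂B := fun a =>
    lintegral_prod _ (by fun_prop)
  simp_rw [h1]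
  rw [lintegral_lintegral_swap]
  · refine lintegral_congr fun b => ?_
    rw [lintegral_prod _ (by fun_prop)]
  · refine Measurable.aemeasurable ?_
    refine Measurable.lintegral_prod_right' (f := fun q : (α × β) × γ => f (q.1.1, q.1.2, q.2)) ?_
    fun_prop

/-- Gaussian conditioning in the presence of a further variable `U` independent of the Gaussian
residual `ρ`. -/
theorem map_innovation_prod {Ω α : Type*} [MeasurableSpace Ω] [MeasurableSpace α]
    {M : Measure Ω} {K : Matrix 𝒳 𝒳 ℝ} (hK : K.PosSemidef) {v : ℝ≥0} (hv : 0 < v) (a : 𝒳)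
    {ρ : Ω → EuclideanSpace ℝ 𝒳} {U : Ω → α} {ε : Ω → ℝ} (hρ : Measurable ρ) (hU : Measurable U)
    (hε : Measurable ε) {ν : Measure α} [SFinite ν]
    (hM : M.map (fun ω => (ρ ω, U ω)) = (multivariateGaussian 0 K).prod ν)
    (hMε : M.map (fun ω => ((ρ ω, U ω), ε ω))
      = (M.map (fun ω => (ρ ω, U ω))).prod (gaussianReal 0 v)) :
    M.map (fun ω => (ρ ω - (ρ ω a + ε ω) • gain K v a, U ω, ρ ω a + ε ω))
      = (multivariateGaussian 0 (condCov K v a)).prod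
          (ν.prod (gaussianReal 0 (innovVar K v a))) := by
  let Φ : (EuclideanSpace ℝ 𝒳 × α) × ℝ → EuclideanSpace ℝ 𝒳 × α × ℝ := fun p =>
    (p.1.1 - (p.1.1 a + p.2) • gain K v a, p.1.2, p.1.1 a + p.2)
  have hΦ : Measurable Φ := by fun_prop
  have h1 : M.map (fun ω => (ρ ω - (ρ ω a + ε ω) • gain K v a, U ω, ρ ω a + ε ω))
      = (((multivariateGaussian 0 K).prod ν).prod (gaussianReal 0 v)).map Φ := by
    rw [← hM, ← hMε, Measure.map_map hΦ (by fun_prop)]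
    rfl
  rw [h1]
  refine Measure.ext_of_lintegral _ fun f hf => ?_
  rw [lintegral_map hf hΦ, lintegral_prod_prod_swap _ _ _ hf]
  -- For each frozen value of `U` this is the one-step identity without `U`.
  have h2 : ∀ u, ∫⁻ q, f (q.1, u, q.2) ∂((multivariateGaussian 0 (condCov K v a)).prod
          (gaussianReal 0 (innovVar K v a)))
      = ∫⁻ q, f (Φ ((q.1, u), q.2)) ∂((multivariateGaussian 0 K).prod (gaussianReal 0 v)) := by
    intro u
    rw [← map_innovation hK hv a, lintegral_map (by fun_prop) (by fun_prop)]
  simp_rw [h2]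
  rw [← lintegral_prod_prod_swap (multivariateGaussian 0 K) ν (gaussianReal 0 v)
    (f := fun p => f (Φ ((p.1, p.2.1), p.2.2))) (by fun_prop),
    ← Measure.prodAssoc_prod, lintegral_map (by fun_prop) (by fun_prop)]
  rfl

/-- The posterior covariance after `t` observations at the locations `l`. -/
def postCov (S : Matrix 𝒳 𝒳 ℝ) (s : Fin T → 𝒳 → ℝ≥0) (l : Fin T → 𝒳) : ℕ → Matrix 𝒳 𝒳 ℝ
  | 0 => S
  | t + 1 => if h : t < T then
      condCov (postCov S s l t) (s ⟨t, h⟩ (l ⟨t, h⟩) ^ 2) (l ⟨t, h⟩) else postCov S s l t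

/-- The posterior mean after `t` observations with values `y` at the locations `l`. -/
def postMean (μ : EuclideanSpace ℝ 𝒳) (S : Matrix 𝒳 𝒳 ℝ) (s : Fin T → 𝒳 → ℝ≥0) (l : Fin T → 𝒳)
    (y : Fin T → ℝ) : ℕ → EuclideanSpace ℝ 𝒳
  | 0 => μ
  | t + 1 => if h : t < T then
      postMean μ S s l y t + (y ⟨t, h⟩ - postMean μ S s l y t (l ⟨t, h⟩)) •
        gain (postCov S s l t) (s ⟨t, h⟩ (l ⟨t, h⟩) ^ 2) (l ⟨t, h⟩) else postMean μ S s l y t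

/-- The first `t` entries of `y`, completed by zeros. -/
def trunc (t : ℕ) (y : Fin T → ℝ) : Fin T → ℝ := fun i => if (i : ℕ) < t then y i else 0

variable {μ : EuclideanSpace ℝ 𝒳} {S : Matrix 𝒳 𝒳 ℝ} {s : Fin T → 𝒳 → ℝ≥0}

lemma postCov_succ (l : Fin T → 𝒳) (t : Fin T) :
    postCov S s l (t + 1) = condCov (postCov S s l t) (s t (l t) ^ 2) (l t) := by
  simp [postCov]

lemma postMean_succ (l : Fin T → 𝒳) (y : Fin T → ℝ) (t : Fin T) :
    postMean μ S s l y (t + 1) = postMean μ S s l y t + (y t - postMean μ S s l y t (l t)) •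
        gain (postCov S s l t) (s t (l t) ^ 2) (l t) := by
  simp [postMean]

lemma postCov_congr {l l' : Fin T → 𝒳} {t : ℕ} (h : ∀ i : Fin T, (i : ℕ) < t → l i = l' i) :
    postCov S s l t = postCov S s l' t := by
  induction t with
  | zero => rfl
  | succ t ih =>
    simp only [postCov, ih fun i hi => h i (by omega)]
    split_ifs with ht
    · rw [h ⟨t, ht⟩ (by simp)]
    · rfl

lemma postMean_congr {l l' : Fin T → 𝒳} {y y' : Fin T → ℝ} {t : ℕ}
    (h : ∀ i : Fin T, (i : ℕ) < t → l i = l' i) (hy : ∀ i : Fin T, (i : ℕ) < t → y i = y' i) :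
    postMean μ S s l y t = postMean μ S s l' y' t := by
  induction t with
  | zero => rfl
  | succ t ih =>
    simp only [postMean, ih (fun i hi => h i (by omega)) (fun i hi => hy i (by omega)),
      postCov_congr (S := S) (s := s) (t := t) fun i hi => h i (by omega)]
    split_ifs with ht
    · rw [h ⟨t, ht⟩ (by simp), hy ⟨t, ht⟩ (by simp)]
    · rfl

lemma postMean_trunc (l : Fin T → 𝒳) (y : Fin T → ℝ) {t u : ℕ} (htu : t ≤ u) :
    postMean μ S s l (trunc u y) t = postMean μ S s l y t :=
  postMean_congr (fun _ _ => rfl) fun i hi => by simp [trunc, hi.trans_le htu]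

@[fun_prop]
lemma measurable_postMean (l : Fin T → 𝒳) (t : ℕ) :
    Measurable fun y => postMean μ S s l y t := by
  induction t with
  | zero => simp [postMean]
  | succ t ih =>
    simp only [postMean]
    split_ifs with h
    · fun_prop
    · exact ih

@[fun_prop]
lemma measurable_trunc (t : ℕ) : Measurable (trunc (T := T) t) := by
  refine measurable_pi_lambda _ fun i => ?_
  unfold trunc
  split_ifs <;> fun_prop

lemma trunc_succ (t : Fin T) (y : Fin T → ℝ) :
    trunc (t + 1) y = Function.update (trunc t y) t (y t) := by
  ext i
  by_cases h : i = t
  · subst h; simp [trunc]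
  · have : (i : ℕ) ≠ t := fun h' => h (Fin.ext h')
    have h2 : (i : ℕ) < t + 1 ↔ (i : ℕ) < t := by omega
    simp [trunc, h, h2]

lemma trunc_zero (y : Fin T → ℝ) : trunc 0 y = 0 := by ext; simp [trunc]

lemma trunc_self (y : Fin T → ℝ) : trunc T y = y := by ext; simp [trunc]

lemma posSemidef_postCov (hS : S.PosSemidef) (hs0 : ∀ n a, 0 < s n a) (l : Fin T → 𝒳) (t : ℕ) :
    (postCov S s l t).PosSemidef := by
  induction t with
  | zero => exact hS
  | succ t ih =>
    simp only [postCov]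
    split_ifs with h
    · exact posSemidef_condCov ih (pow_pos (hs0 _ _) 2)
    · exact ih

lemma postCov_diag_le (l : Fin T → 𝒳) (t : ℕ) (a : 𝒳) : postCov S s l t a a ≤ S a a := by
  induction t with
  | zero => exact le_rfl
  | succ t ih =>
    simp only [postCov]
    split_ifs with h
    · exact (condCov_diag_le a).trans ih
    · exact ih

/-- The variance of the innovation of round `t` at the locations `l`. -/
def predVar (S : Matrix 𝒳 𝒳 ℝ) (s : Fin T → 𝒳 → ℝ≥0) (l : Fin T → 𝒳) (t : Fin T) : ℝ≥0 :=
  innovVar (postCov S s l t) (s t (l t) ^ 2) (l t)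

/-- The observations of the first `t + 1` rounds from those of the first `t` rounds and the
innovation of round `t`. -/
def extend (μ : EuclideanSpace ℝ 𝒳) (S : Matrix 𝒳 𝒳 ℝ) (s : Fin T → 𝒳 → ℝ≥0) (l : Fin T → 𝒳)
    (t : Fin T) (p : (Fin T → ℝ) × ℝ) : Fin T → ℝ :=
  Function.update p.1 t (postMean μ S s l p.1 t (l t) + p.2)

@[fun_prop]
lemma measurable_extend (l : Fin T → 𝒳) (t : Fin T) : Measurable (extend μ S s l t) := by
  refine measurable_pi_lambda _ fun i => ?_
  unfold extend
  by_cases h : i = t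
  · subst h
    simp only [Function.update_self]
    have : Measurable fun p : (Fin T → ℝ) × ℝ => postMean μ S s l p.1 i :=
      (measurable_postMean l i).comp measurable_fst
    fun_prop
  · simp only [Function.update_of_ne h]
    fun_prop

/-- One round of Gaussian filtering: the residual stays Gaussian with the posterior covariance and
independent of the observations and of the hidden variable. -/
theorem map_residual_succ {Ω α : Type*} [MeasurableSpace Ω] [MeasurableSpace α]
    {M : Measure Ω} (hS : S.PosSemidef) (hs0 : ∀ n a, 0 < s n a) (l : Fin T → 𝒳) (t : Fin T)
    {R : Ω → EuclideanSpace ℝ 𝒳} {h : Ω → α} {y : Ω → Fin T → ℝ} {ε : Ω → ℝ} (hR : Measurable R)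
    (hh : Measurable h) (hy : Measurable y) (hε : Measurable ε)
    {H : Measure α} [SFinite H] {ν : Measure (Fin T → ℝ)} [SFinite ν]
    (hM : M.map (fun ω => (R ω - postMean μ S s l (y ω) t, h ω, trunc t (y ω)))
      = (multivariateGaussian 0 (postCov S s l t)).prod (H.prod ν))
    (hMε : M.map (fun ω => ((R ω - postMean μ S s l (y ω) t, h ω, trunc t (y ω)), ε ω))
      = (M.map (fun ω => (R ω - postMean μ S s l (y ω) t, h ω, trunc t (y ω)))).prod
          (gaussianReal 0 (s t (l t) ^ 2)))
    (hyt : ∀ᵐ ω ∂M, y ω t = R ω (l t) + ε ω) :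
    M.map (fun ω => (R ω - postMean μ S s l (y ω) (t + 1), h ω, trunc (t + 1) (y ω)))
      = (multivariateGaussian 0 (postCov S s l (t + 1))).prod
          (H.prod ((ν.prod (gaussianReal 0 (predVar S s l t))).map (extend μ S s l t))) := by
  have hm : Measurable fun ω => postMean μ S s l (y ω) t := (measurable_postMean l t).comp hy
  have hty : Measurable fun ω => trunc t (y ω) := (measurable_trunc t).comp hy
  have key := map_innovation_prod (M := M) (posSemidef_postCov hS hs0 l t)
    (pow_pos (hs0 t (l t)) 2) (l t) (hR.sub hm) (hh.prodMk hty) hε hM hMε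
  let g : EuclideanSpace ℝ 𝒳 × (α × (Fin T → ℝ)) × ℝ → EuclideanSpace ℝ 𝒳 × α × (Fin T → ℝ) :=
    fun p => (p.1, p.2.1.1, extend μ S s l t (p.2.1.2, p.2.2))
  have hg : Measurable g := by fun_prop
  have e1 : M.map (fun ω => (R ω - postMean μ S s l (y ω) (t + 1), h ω, trunc (t + 1) (y ω)))
      = (M.map (fun ω => (R ω - postMean μ S s l (y ω) t - ((R ω - postMean μ S s l (y ω) t) (l t)
          + ε ω) • gain (postCov S s l t) (s t (l t) ^ 2) (l t), (h ω, trunc t (y ω)),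
            (R ω - postMean μ S s l (y ω) t) (l t) + ε ω))).map g := by
    rw [Measure.map_map hg (by fun_prop)]
    refine Measure.map_congr ?_
    filter_upwards [hyt] with ω hω
    -- The innovation is the observation minus its prediction, so subtracting gain times innovation
    -- is exactly the update of the posterior mean.
    have hW : (R ω - postMean μ S s l (y ω) t) (l t) + ε ω
        = y ω t - postMean μ S s l (y ω) t (l t) := by
      rw [hω]; simp; ring
    simp only [Function.comp_apply, g, hW, extend, postMean_trunc l _ le_rfl, trunc_succ,
      postMean_succ]
    simp [sub_sub]
  have key' := congrArg (Measure.map g) key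
  rw [e1]
  refine key'.trans ?_
  rw [← postCov_succ]
  refine Measure.ext_of_lintegral _ fun f hf => ?_
  rw [lintegral_map hf hg, lintegral_prod _ (by fun_prop), lintegral_prod _ (by fun_prop)]
  refine lintegral_congr fun z => ?_
  rw [lintegral_prod _ (by fun_prop), lintegral_prod _ (by fun_prop),
    lintegral_prod _ (by fun_prop)]
  refine lintegral_congr fun u => ?_
  rw [lintegral_map (by fun_prop) (by fun_prop), lintegral_prod _ (by fun_prop)]
  rfl

end Filtering

/-! ### Closed form of the information gain and the bound on the sum of posterior variances. -/

section InformationGain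

variable {𝒳 : Type*} [Fintype 𝒳] [DecidableEq 𝒳] {T : ℕ}
variable {μ : EuclideanSpace ℝ 𝒳} {S : Matrix 𝒳 𝒳 ℝ} {s : Fin T → 𝒳 → ℝ≥0}

lemma map_trunc_prod_eval (G : Fin T → Measure ℝ) [∀ i, IsProbabilityMeasure (G i)] (t : Fin T) :
    (Measure.pi G).map (fun e => (trunc t e, e t)) = ((Measure.pi G).map (trunc t)).prod (G t) := by
  have hind : iIndepFun (fun i (e : Fin T → ℝ) => e i) (Measure.pi G) :=
    iIndepFun_pi (X := fun _ => id) fun i => aemeasurable_id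
  have h := hind.indepFun_finset (Finset.univ.filter fun i : Fin T => (i : ℕ) < t) {t}
    (by simp) fun i => measurable_pi_apply i
  let g : ((Finset.univ.filter fun i : Fin T => (i : ℕ) < t) → ℝ) → Fin T → ℝ := fun z i =>
    if hi : (i : ℕ) < t then z ⟨i, by simpa using hi⟩ else 0
  have hg : Measurable g := by
    refine measurable_pi_lambda _ fun i => ?_
    unfold g
    split_ifs <;> fun_prop
  let g' : (({t} : Finset (Fin T)) → ℝ) → ℝ := fun z => z ⟨t, by simp⟩
  have hg' : Measurable g' := measurable_pi_apply _
  have h2 := h.comp hg hg'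
  have e1 : (g ∘ fun (e : Fin T → ℝ) (i : (Finset.univ.filter fun i : Fin T => (i : ℕ) < t)) => e i)
      = trunc t := by
    ext e i
    simp [g, trunc]
  rw [e1] at h2
  have h3 := (indepFun_iff_map_prod_eq_prod_map_map (measurable_trunc _).aemeasurable
    (measurable_pi_apply t).aemeasurable).1 h2
  rw [(measurePreserving_eval (μ := G) t).map_eq] at h3
  exact h3

lemma map_prod_snd {α β γ : Type*} [MeasurableSpace α] [MeasurableSpace β] [MeasurableSpace γ]
    {A : Measure α} {B : Measure β} [SFinite A] [SFinite B] {f : β → γ} (hf : Measurable f) :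
    (A.prod B).map (fun p => (p.1, f p.2)) = A.prod (B.map f) := by
  conv_rhs => rw [← Measure.map_id (μ := A)]
  rw [Measure.map_prod_map _ _ measurable_id hf]
  rfl

/-- An independence inside the second factor survives the addition of a first factor; it is used to
detach the noise of the current round from the rewards and the earlier noise. -/
lemma map_prod_of_map_prod {α β γ δ : Type*} [MeasurableSpace α] [MeasurableSpace β]
    [MeasurableSpace γ] [MeasurableSpace δ] {A : Measure α} {B : Measure β} {G : Measure δ}
    [SFinite A] [SFinite B] [SFinite G] {f : β → γ} {g : β → δ} (hf : Measurable f)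
    (hg : Measurable g) (h : B.map (fun e => (f e, g e)) = (B.map f).prod G) :
    (A.prod B).map (fun p => ((p.1, f p.2), g p.2))
      = ((A.prod B).map (fun p => (p.1, f p.2))).prod G := by
  refine MeasurableEquiv.prodAssoc.map_measurableEquiv_injective ?_
  rw [map_prod_snd hf, Measure.prodAssoc_prod, ← h, ← map_prod_snd (by fun_prop),
    Measure.map_map (by fun_prop) (by fun_prop)]
  rfl

/-- The law of the first `t` observations at the locations `l`. -/
def obsLaw (μ : EuclideanSpace ℝ 𝒳) (S : Matrix 𝒳 𝒳 ℝ) (s : Fin T → 𝒳 → ℝ≥0) (l : Fin T → 𝒳) :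
    ℕ → Measure (Fin T → ℝ)
  | 0 => Measure.dirac 0
  | t + 1 => if h : t < T then
      ((obsLaw μ S s l t).prod (gaussianReal 0 (predVar S s l ⟨t, h⟩))).map
        (extend μ S s l ⟨t, h⟩) else obsLaw μ S s l t

lemma obsLaw_succ (l : Fin T → 𝒳) (t : Fin T) :
    obsLaw μ S s l (t + 1) = ((obsLaw μ S s l t).prod (gaussianReal 0 (predVar S s l t))).map
        (extend μ S s l t) := by
  simp [obsLaw]

instance (l : Fin T → 𝒳) (t : ℕ) : IsProbabilityMeasure (obsLaw μ S s l t) := by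
  induction t with
  | zero => exact Measure.dirac.isProbabilityMeasure
  | succ t ih =>
    simp only [obsLaw]
    split_ifs with h
    · exact Measure.isProbabilityMeasure_map (measurable_extend l _).aemeasurable
    · exact ih

/-- The joint law of the reward vector and the independent noise at the locations `l`. -/
def noiseLaw (μ : EuclideanSpace ℝ 𝒳) (S : Matrix 𝒳 𝒳 ℝ) (s : Fin T → 𝒳 → ℝ≥0) (l : Fin T → 𝒳) :
    Measure (EuclideanSpace ℝ 𝒳 × (Fin T → ℝ)) :=
  (multivariateGaussian μ S).prod (Measure.pi fun t : Fin T => gaussianReal 0 (s t (l t) ^ 2))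

instance (l : Fin T → 𝒳) : IsProbabilityMeasure (noiseLaw μ S s l) := by
  unfold noiseLaw; infer_instance

lemma map_sub_multivariateGaussian (hS : S.PosSemidef) :
    (multivariateGaussian μ S).map (fun z => z - μ) = multivariateGaussian 0 S := by
  have := Measure.isProbabilityMeasure_map (μ := multivariateGaussian μ S)
    (f := fun z => z - μ) (by fun_prop)
  refine Measure.ext_of_charFun (funext fun x => ?_)
  simp_rw [sub_eq_add_neg]
  rw [charFun_map_add_const, charFun_multivariateGaussian hS, charFun_multivariateGaussian hS,
    ← Complex.exp_add]
  congr 1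
  rw [inner_neg_left, real_inner_comm]
  simp
  ring

/-- The filtering step iterated from the prior. The hidden variable of `map_residual_succ` is not
needed here and is taken to be a point of `Unit`. -/
lemma map_residual_noiseLaw (hS : S.PosSemidef) (hs0 : ∀ n a, 0 < s n a) (l : Fin T → 𝒳) {t : ℕ}
    (ht : t ≤ T) :
    (noiseLaw μ S s l).map (fun p => (p.1 - postMean μ S s l (fun i => p.1 (l i) + p.2 i) t, (),
        trunc t (fun i => p.1 (l i) + p.2 i)))
      = (multivariateGaussian 0 (postCov S s l t)).prod
          ((Measure.dirac ()).prod (obsLaw μ S s l t)) := by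
  induction t with
  | zero =>
    simp only [postMean, trunc_zero, postCov, obsLaw, Measure.dirac_prod_dirac]
    rw [Measure.prod_dirac, ← map_sub_multivariateGaussian (μ := μ) hS,
      Measure.map_map (by fun_prop) (by fun_prop)]
    have : multivariateGaussian μ S = (noiseLaw μ S s l).map Prod.fst := by
      simp [noiseLaw]
    rw [this, Measure.map_map (by fun_prop) (by fun_prop)]
    rfl
  | succ t ih =>
    have hy : Measurable fun p : EuclideanSpace ℝ 𝒳 × (Fin T → ℝ) =>
      (fun i => p.1 (l i) + p.2 i : Fin T → ℝ) := by fun_prop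
    have h := map_residual_succ (M := noiseLaw μ S s l) (μ := μ) hS hs0 l ⟨t, ht⟩
      (R := Prod.fst) (h := fun _ => ()) (y := fun p i => p.1 (l i) + p.2 i)
      (ε := fun p => p.2 ⟨t, ht⟩) measurable_fst measurable_const hy (by fun_prop)
      (H := Measure.dirac ()) (ν := obsLaw μ S s l t) (ih (by omega)) ?_ (by simp)
    · rw [← obsLaw_succ] at h
      exact h
    · let g : EuclideanSpace ℝ 𝒳 × (Fin T → ℝ) → EuclideanSpace ℝ 𝒳 × Unit × (Fin T → ℝ) :=
        fun p => (p.1 - postMean μ S s l (fun i => p.1 (l i) + p.2 i) t, (),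
          trunc t (fun i => p.1 (l i) + p.2 i))
      have hg : Measurable g := by
        have := (measurable_postMean (μ := μ) (S := S) (s := s) l t).comp hy
        have := (measurable_trunc t).comp hy
        simp only [Function.comp_def] at *
        fun_prop
      -- The state after `t` rounds uses only the first `t` noise variables, hence is independent of
      -- the noise with index `t`.
      have e : ∀ p : EuclideanSpace ℝ 𝒳 × (Fin T → ℝ), g p = g (p.1, trunc t p.2) := by
        intro p
        simp only [g]
        rw [postMean_congr (l' := l) (y' := fun i => p.1 (l i) + trunc t p.2 i)
          (fun _ _ => rfl) fun i hi => by simp [trunc, hi]]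
        congr 2
        ext i
        by_cases hi : (i : ℕ) < t <;> simp [trunc, hi]
      have m0 := map_trunc_prod_eval (fun i => gaussianReal 0 (s i (l i) ^ 2)) ⟨t, ht⟩
      have m1 : (noiseLaw μ S s l).map (fun p => ((p.1, trunc t p.2), p.2 ⟨t, ht⟩))
          = ((noiseLaw μ S s l).map (fun p => (p.1, trunc t p.2))).prod
            (gaussianReal 0 (s ⟨t, ht⟩ (l ⟨t, ht⟩) ^ 2)) := by
        exact map_prod_of_map_prod (by fun_prop) (by fun_prop) m0
      have m2 := congrArg (Measure.map (Prod.map g (id : ℝ → ℝ))) m1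
      rw [← Measure.map_prod_map _ _ hg measurable_id, Measure.map_map hg (by fun_prop),
        Measure.map_map (by fun_prop) (by fun_prop), Measure.map_id] at m2
      have c1 : (Prod.map g (id : ℝ → ℝ)) ∘ (fun p => ((p.1, trunc t p.2), p.2 ⟨t, ht⟩))
          = fun p => (g p, p.2 ⟨t, ht⟩) := by
        ext1 p; simp [e p]
      have c2 : g ∘ (fun p => (p.1, trunc t p.2)) = g := by
        ext1 p; exact (e p).symm
      rw [c1, c2] at m2
      exact m2


/-- The law of the observations at the locations `l` given the reward vector `z`. -/
def condObsLaw (s : Fin T → 𝒳 → ℝ≥0) (l : Fin T → 𝒳) (z : EuclideanSpace ℝ 𝒳) :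
    Measure (Fin T → ℝ) :=
  Measure.pi fun i => gaussianReal (z (l i)) (s i (l i) ^ 2)

instance (l : Fin T → 𝒳) (z : EuclideanSpace ℝ 𝒳) : IsProbabilityMeasure (condObsLaw s l z) := by
  unfold condObsLaw; infer_instance

lemma map_add_pi_gaussianReal (l : Fin T → 𝒳) (z : EuclideanSpace ℝ 𝒳) :
    (Measure.pi fun i : Fin T => gaussianReal 0 (s i (l i) ^ 2)).map (fun e i => z (l i) + e i)
      = condObsLaw s l z := by
  have := Measure.pi_map_pi (μ := fun i : Fin T => gaussianReal 0 (s i (l i) ^ 2))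
    (f := fun i e => z (l i) + e) (fun i => by fun_prop)
  refine this.trans ?_
  simp only [gaussianReal_map_const_add, zero_add, condObsLaw]

lemma map_trunc_succ_condObsLaw (l : Fin T → 𝒳) (z : EuclideanSpace ℝ 𝒳) (t : Fin T) :
    (condObsLaw s l z).map (trunc (t + 1))
      = (((condObsLaw s l z).map (trunc t)).prod (gaussianReal (z (l t)) (s t (l t) ^ 2))).map
          (fun p => Function.update p.1 t p.2) := by
  have hup : Measurable fun p : (Fin T → ℝ) × ℝ => Function.update p.1 t p.2 := by
    refine measurable_pi_lambda _ fun i => ?_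
    by_cases h : i = t
    · subst h; simp only [Function.update_self]; fun_prop
    · simp only [Function.update_of_ne h]; fun_prop
  rw [condObsLaw, ← map_trunc_prod_eval _ t, Measure.map_map hup (by fun_prop)]
  congr 1
  ext1 y
  simp [trunc_succ]

/-- The density of the observation of round `i` given `z`, relative to its density given the past
observations. -/
def likelihoodRatio (μ : EuclideanSpace ℝ 𝒳) (S : Matrix 𝒳 𝒳 ℝ) (s : Fin T → 𝒳 → ℝ≥0)
    (l : Fin T → 𝒳) (i : Fin T) (p : EuclideanSpace ℝ 𝒳 × (Fin T → ℝ)) : ℝ≥0∞ :=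
  ENNReal.ofReal (gaussianPDFReal (p.1 (l i)) (s i (l i) ^ 2) (p.2 i) /
    gaussianPDFReal (postMean μ S s l p.2 i (l i)) (predVar S s l i) (p.2 i))

lemma predVar_pos (hs0 : ∀ n a, 0 < s n a) (l : Fin T → 𝒳) (i : Fin T) : 0 < predVar S s l i :=
  innovVar_pos (pow_pos (hs0 _ _) 2)

@[fun_prop]
lemma measurable_postMean_snd_apply (l : Fin T → 𝒳) (t : ℕ) (a : 𝒳) :
    Measurable fun p : EuclideanSpace ℝ 𝒳 × (Fin T → ℝ) => postMean μ S s l p.2 t a := by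
  have : Measurable fun p : EuclideanSpace ℝ 𝒳 × (Fin T → ℝ) => postMean μ S s l p.2 t :=
    (measurable_postMean l t).comp measurable_snd
  fun_prop

@[fun_prop]
lemma measurable_likelihoodRatio (l : Fin T → 𝒳) (i : Fin T) :
    Measurable (likelihoodRatio μ S s l i) := by
  unfold likelihoodRatio gaussianPDFReal
  fun_prop

/-- Each round multiplies the density by the ratio of the observation density given `z` to the
predictive density given the past. The reference law is the law of the observations alone, so the
product is the density of the joint law relative to its marginals. -/
lemma map_trunc_condObsLaw (hs0 : ∀ n a, 0 < s n a) (l : Fin T → 𝒳) (z : EuclideanSpace ℝ 𝒳)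
    {t : ℕ} (ht : t ≤ T) :
    (condObsLaw s l z).map (trunc t) = (obsLaw μ S s l t).withDensity
      fun Y => ∏ i ∈ Finset.univ.filter (fun i : Fin T => (i : ℕ) < t), likelihoodRatio μ S s l i (z, Y) := by
  induction t with
  | zero =>
    have : (trunc 0 : (Fin T → ℝ) → Fin T → ℝ) = fun _ => 0 := by ext1 y; exact trunc_zero y
    simp only [this, Measure.map_const, measure_univ, one_smul, obsLaw, not_lt_zero,
      Finset.filter_false, Finset.prod_empty]
    exact withDensity_one.symm
  | succ t ih =>
    obtain ⟨t, rfl⟩ : ∃ u : Fin T, (u : ℕ) = t := ⟨⟨t, ht⟩, rfl⟩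
    specialize ih (by omega)
    have hup : Measurable fun p : (Fin T → ℝ) × ℝ => Function.update p.1 t p.2 := by
      refine measurable_pi_lambda _ fun i => ?_
      by_cases h : i = t
      · subst h; simp only [Function.update_self]; fun_prop
      · simp only [Function.update_of_ne h]; fun_prop
    have hD : ∀ u : ℕ, Measurable fun Y : Fin T → ℝ =>
        ∏ i ∈ Finset.univ.filter (fun i : Fin T => (i : ℕ) < u), likelihoodRatio μ S s l i (z, Y) := by
      intro u; fun_prop
    have hV : predVar S s l t ≠ 0 := (predVar_pos hs0 l t).ne'
    have hv : s t (l t) ^ 2 ≠ 0 := (pow_pos (hs0 _ _) 2).ne'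
    have hsplit : ∀ (Y : Fin T → ℝ) (u : ℝ),
        ∏ i ∈ Finset.univ.filter (fun i : Fin T => (i : ℕ) < t + 1), likelihoodRatio μ S s l i (z, Function.update Y t u)
          = (∏ i ∈ Finset.univ.filter (fun i : Fin T => (i : ℕ) < t), likelihoodRatio μ S s l i (z, Y)) *
            ENNReal.ofReal (gaussianPDFReal (z (l t)) (s t (l t) ^ 2) u /
              gaussianPDFReal (postMean μ S s l Y t (l t)) (predVar S s l t) u) := by
      intro Y u
      have hf : (Finset.univ.filter fun i : Fin T => (i : ℕ) < t + 1)
          = insert t (Finset.univ.filter fun i : Fin T => (i : ℕ) < t) := by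
        ext i
        simp only [Finset.mem_filter, Finset.mem_univ, true_and, Finset.mem_insert, Fin.ext_iff]
        omega
      have hpm : ∀ i : Fin T, (i : ℕ) ≤ t →
          postMean μ S s l (Function.update Y t u) i = postMean μ S s l Y i := fun i hi =>
        postMean_congr (fun _ _ => rfl) fun j hj =>
          Function.update_of_ne (fun h => by subst h; omega) _ _
      rw [hf, Finset.prod_insert (by simp), mul_comm]
      congr 1
      · refine Finset.prod_congr rfl fun i hi => ?_
        have hi' : (i : ℕ) < t := by simpa using hi
        have hne : i ≠ t := fun h => by subst h; omega
        simp [likelihoodRatio, hpm i hi'.le, hne]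
      · simp [likelihoodRatio, hpm t le_rfl]
    refine Measure.ext_of_lintegral _ fun f hf => ?_
    rw [map_trunc_succ_condObsLaw, ih, lintegral_map hf hup, lintegral_prod _ (by fun_prop),
      lintegral_withDensity_eq_lintegral_mul _ (hD t) (by fun_prop),
      lintegral_withDensity_eq_lintegral_mul _ (hD _) hf, obsLaw_succ,
      lintegral_map (by fun_prop) (by fun_prop), lintegral_prod _ (by fun_prop)]
    refine lintegral_congr fun Y => ?_
    -- Passing from the innovation to the observation shifts the centred Gaussian by the predicted
    -- value.
    have h1 : ∫⁻ w, ((fun Y => ∏ i ∈ Finset.univ.filter (fun i : Fin T => (i : ℕ) < t + 1), likelihoodRatio μ S s l i (z, Y))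
        * f) (extend μ S s l t (Y, w)) ∂(gaussianReal 0 (predVar S s l t))
        = ∫⁻ u, ((fun Y => ∏ i ∈ Finset.univ.filter (fun i : Fin T => (i : ℕ) < t + 1), likelihoodRatio μ S s l i (z, Y))
        * f) (Function.update Y t u)
          ∂(gaussianReal (postMean μ S s l Y t (l t)) (predVar S s l t)) := by
      rw [← zero_add (postMean μ S s l Y t (l t)), ← gaussianReal_map_const_add,
        lintegral_map (by fun_prop) (by fun_prop)]
      rfl
    rw [h1]
    simp only [Pi.mul_apply, hsplit]
    rw [gaussianReal_of_var_ne_zero _ hV, gaussianReal_of_var_ne_zero _ hv,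
      lintegral_withDensity_eq_lintegral_mul _ (by fun_prop) (by fun_prop),
      lintegral_withDensity_eq_lintegral_mul _ (by fun_prop)
        (by unfold gaussianPDFReal; fun_prop),
      ← lintegral_const_mul _ (by fun_prop)]
    refine lintegral_congr fun u => ?_
    have h2 : gaussianPDF (postMean μ S s l Y t (l t)) (predVar S s l t) u *
        ENNReal.ofReal (gaussianPDFReal (z (l t)) (s t (l t) ^ 2) u /
          gaussianPDFReal (postMean μ S s l Y t (l t)) (predVar S s l t) u)
        = gaussianPDF (z (l t)) (s t (l t) ^ 2) u := by
      rw [gaussianPDF, gaussianPDF, ← ENNReal.ofReal_mul (gaussianPDFReal_nonneg _ _ _),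
        mul_div_cancel₀ _ (gaussianPDFReal_pos _ _ _ hV).ne']
    simp only [Pi.mul_apply]
    rw [← h2]
    ring

lemma observationLaw_fst (l : Fin T → 𝒳) :
    (observationLaw μ S s l).fst = multivariateGaussian μ S := by
  rw [observationLaw, Measure.fst, Measure.map_map (by fun_prop) (by fun_prop)]
  have : (Prod.fst ∘ fun p : EuclideanSpace ℝ 𝒳 × (Fin T → ℝ) => (p.1, fun t => p.1 (l t) + p.2 t))
    = Prod.fst := rfl
  rw [this, ← Measure.fst, Measure.fst_prod]

lemma map_trunc_noiseLaw (hS : S.PosSemidef) (hs0 : ∀ n a, 0 < s n a) (l : Fin T → 𝒳) {t : ℕ}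
    (ht : t ≤ T) :
    (noiseLaw μ S s l).map (fun p => trunc t (fun i => p.1 (l i) + p.2 i)) = obsLaw μ S s l t := by
  have h := congrArg (Measure.map fun q : EuclideanSpace ℝ 𝒳 × Unit × (Fin T → ℝ) => q.2.2)
    (map_residual_noiseLaw (μ := μ) hS hs0 l ht)
  have hp : Measurable fun p : EuclideanSpace ℝ 𝒳 × (Fin T → ℝ) =>
      postMean μ S s l (fun i => p.1 (l i) + p.2 i) t :=
    (measurable_postMean l t).comp (by fun_prop)
  rw [Measure.map_map (by fun_prop) (by fun_prop)] at h
  refine h.trans ?_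
  have : (fun q : EuclideanSpace ℝ 𝒳 × Unit × (Fin T → ℝ) => q.2.2) = Prod.snd ∘ Prod.snd := rfl
  rw [this, ← Measure.map_map (by fun_prop) (by fun_prop)]
  change (Measure.snd (Measure.snd _)) = _
  rw [Measure.snd_prod, Measure.snd_prod]

lemma observationLaw_snd (hS : S.PosSemidef) (hs0 : ∀ n a, 0 < s n a) (l : Fin T → 𝒳) :
    (observationLaw μ S s l).snd = obsLaw μ S s l T := by
  rw [← map_trunc_noiseLaw hS hs0 l le_rfl, observationLaw, Measure.snd,
    Measure.map_map (by fun_prop) (by fun_prop)]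
  simp only [trunc_self]
  rfl

/-- The joint law of rewards and observations has the product of the likelihood ratios as density
relative to the product of its marginals. -/
theorem observationLaw_eq_withDensity (hs0 : ∀ n a, 0 < s n a) (l : Fin T → 𝒳) :
    observationLaw μ S s l = ((multivariateGaussian μ S).prod (obsLaw μ S s l T)).withDensity
      fun p => ∏ i, likelihoodRatio μ S s l i p := by
  refine Measure.ext_of_lintegral _ fun f hf => ?_
  rw [observationLaw, lintegral_map hf (by fun_prop), lintegral_prod _ (by fun_prop),
    lintegral_withDensity_eq_lintegral_mul _ (by fun_prop) hf, lintegral_prod _ (by fun_prop)]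
  refine lintegral_congr fun z => ?_
  have h := map_trunc_condObsLaw (μ := μ) (S := S) hs0 l z le_rfl
  have e : (trunc T : (Fin T → ℝ) → Fin T → ℝ) = id := by ext1 y; exact trunc_self y
  rw [e, Measure.map_id] at h
  have h2 : ∫⁻ y, f (z, fun t => z (l t) + y t) ∂(Measure.pi fun t : Fin T =>
      gaussianReal 0 (s t (l t) ^ 2)) = ∫⁻ y, f (z, y) ∂(condObsLaw s l z) := by
    rw [← map_add_pi_gaussianReal, lintegral_map (by fun_prop) (by fun_prop)]
  simp only
  rw [h2, h, lintegral_withDensity_eq_lintegral_mul _ (by fun_prop) (by fun_prop)]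
  simp


lemma integrable_sq_gaussianReal (v : ℝ≥0) : Integrable (fun x => x ^ 2) (gaussianReal 0 v) :=
  (memLp_id_gaussianReal (μ := 0) (v := v) 2).integrable_sq

lemma integral_sq_gaussianReal (v : ℝ≥0) : ∫ x, x ^ 2 ∂(gaussianReal 0 v) = v := by
  have h := variance_id_gaussianReal (μ := 0) (v := v)
  rw [variance_of_integral_eq_zero aemeasurable_id (by simp)] at h
  simpa using h

lemma log_gaussianPDFReal_div {m m' : ℝ} {v V : ℝ≥0} (hv : 0 < v) (hV : 0 < V) (x : ℝ) :
    Real.log (gaussianPDFReal m v x / gaussianPDFReal m' V x)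
      = Real.log (V / v) / 2 - (x - m) ^ 2 / (2 * v) + (x - m') ^ 2 / (2 * V) := by
  have hv' : (0 : ℝ) < v := hv
  have hV' : (0 : ℝ) < V := hV
  have hpi := Real.pi_pos
  rw [Real.log_div (gaussianPDFReal_pos _ _ _ hv.ne').ne' (gaussianPDFReal_pos _ _ _ hV.ne').ne',
    gaussianPDFReal, gaussianPDFReal, Real.log_mul (by positivity) (by positivity),
    Real.log_mul (by positivity) (by positivity), Real.log_exp, Real.log_exp, Real.log_inv,
    Real.log_inv, Real.log_sqrt (by positivity), Real.log_sqrt (by positivity),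
    mul_assoc 2 Real.pi, mul_assoc 2 Real.pi, ← mul_assoc, ← mul_assoc,
    Real.log_mul (by positivity) hv'.ne', Real.log_mul (by positivity) hV'.ne',
    Real.log_div (by positivity) (by positivity)]
  ring

lemma map_noise_observationLaw (l : Fin T → 𝒳) (i : Fin T) :
    (observationLaw μ S s l).map (fun p => p.2 i - p.1 (l i)) = gaussianReal 0 (s i (l i) ^ 2) := by
  rw [observationLaw, Measure.map_map (by fun_prop) (by fun_prop)]
  have : ((fun p : EuclideanSpace ℝ 𝒳 × (Fin T → ℝ) => p.2 i - p.1 (l i)) ∘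
      fun p => (p.1, fun t => p.1 (l t) + p.2 t)) = (fun e : Fin T → ℝ => e i) ∘ Prod.snd := by
    ext1 p; simp
  rw [this, ← Measure.map_map (by fun_prop) (by fun_prop), ← Measure.snd, Measure.snd_prod]
  exact (measurePreserving_eval (μ := fun t : Fin T => gaussianReal 0 (s t (l t) ^ 2)) i).map_eq

/-- In the recursion defining `obsLaw` the innovation of round `i` is the fresh Gaussian factor, and
subtracting the prediction from the extended observations recovers it. -/
lemma map_innovation_observationLaw (hS : S.PosSemidef) (hs0 : ∀ n a, 0 < s n a) (l : Fin T → 𝒳)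
    (i : Fin T) :
    (observationLaw μ S s l).map (fun p => p.2 i - postMean μ S s l p.2 i (l i))
      = gaussianReal 0 (predVar S s l i) := by
  let f : (Fin T → ℝ) → ℝ := fun Y => Y i - postMean μ S s l Y i (l i)
  have hf : Measurable f := by
    have := measurable_postMean (μ := μ) (S := S) (s := s) l i
    fun_prop
  have htm : Measurable fun p : EuclideanSpace ℝ 𝒳 × (Fin T → ℝ) =>
      trunc (i + 1) (fun i => p.1 (l i) + p.2 i) := (measurable_trunc _).comp (by fun_prop)
  have h1 : (observationLaw μ S s l).map (fun p => p.2 i - postMean μ S s l p.2 i (l i))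
      = ((noiseLaw μ S s l).map (fun p => trunc (i + 1) (fun i => p.1 (l i) + p.2 i))).map f := by
    rw [observationLaw, Measure.map_map (by fun_prop) (by fun_prop), noiseLaw,
      Measure.map_map hf htm]
    congr 1
    ext1 p
    simp only [Function.comp_apply, f, postMean_trunc l _ (Nat.le_succ _)]
    simp [trunc]
  rw [h1, map_trunc_noiseLaw hS hs0 l i.2, obsLaw_succ, Measure.map_map hf (by fun_prop)]
  have : f ∘ extend μ S s l i = Prod.snd := by
    ext1 p
    have : postMean μ S s l (extend μ S s l i p) i = postMean μ S s l p.1 i :=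
      postMean_congr (fun _ _ => rfl) fun j hj =>
        Function.update_of_ne (fun h => by subst h; omega) _ _
    simp only [Function.comp_apply, f, this]
    simp [extend]
  rw [this, ← Measure.snd, Measure.snd_prod]

/-- The information gain of observing at the locations `l`. -/
def infoGain (S : Matrix 𝒳 𝒳 ℝ) (s : Fin T → 𝒳 → ℝ≥0) (l : Fin T → 𝒳) : ℝ :=
  ∑ i, Real.log (predVar S s l i / (s i (l i) ^ 2 : ℝ≥0)) / 2

instance (l : Fin T → 𝒳) : IsProbabilityMeasure (observationLaw μ S s l) :=
  Measure.isProbabilityMeasure_map (by fun_prop)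

/-- The log-likelihood ratio is a sum over rounds of a constant and two squares, noise and
innovation, each divided by twice its own variance. Both squares have mean `1 / 2` and opposite
signs, so only the logarithmic constants remain. -/
theorem mutualInformation_observationLaw (hS : S.PosSemidef) (hs0 : ∀ n a, 0 < s n a)
    (l : Fin T → 𝒳) :
    mutualInformation (observationLaw μ S s l) = ENNReal.ofReal (infoGain S s l) := by
  set ν := (multivariateGaussian μ S).prod (obsLaw μ S s l T) with hν
  have hρ := observationLaw_eq_withDensity (μ := μ) (S := S) hs0 l
  have hDm : Measurable fun p => ∏ i, likelihoodRatio μ S s l i p := by fun_prop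
  have hac : observationLaw μ S s l ≪ ν := by
    rw [hρ]; exact withDensity_absolutelyContinuous _ _
  have hrn : (observationLaw μ S s l).rnDeriv ν =ᵐ[ν] fun p => ∏ i, likelihoodRatio μ S s l i p := by
    conv_lhs => rw [hρ]
    exact Measure.rnDeriv_withDensity ν hDm
  have hv : ∀ i, 0 < s i (l i) ^ 2 := fun i => pow_pos (hs0 _ _) 2
  have hV := predVar_pos (S := S) hs0 l
  have hllr : llr (observationLaw μ S s l) ν =ᵐ[observationLaw μ S s l] fun p =>
      ∑ i, (Real.log (predVar S s l i / (s i (l i) ^ 2 : ℝ≥0)) / 2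
        - (p.2 i - p.1 (l i)) ^ 2 / (2 * (s i (l i) ^ 2 : ℝ≥0))
        + (p.2 i - postMean μ S s l p.2 i (l i)) ^ 2 / (2 * predVar S s l i)) := by
    filter_upwards [hac.ae_le hrn] with p hp
    rw [llr, hp, ENNReal.toReal_prod]
    simp only [likelihoodRatio]
    rw [Real.log_prod]
    · refine Finset.sum_congr rfl fun i _ => ?_
      rw [ENNReal.toReal_ofReal (div_nonneg (gaussianPDFReal_nonneg _ _ _)
        (gaussianPDFReal_nonneg _ _ _)), log_gaussianPDFReal_div (hv i) (hV i)]
    · intro i _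
      rw [ENNReal.toReal_ofReal (div_nonneg (gaussianPDFReal_nonneg _ _ _)
        (gaussianPDFReal_nonneg _ _ _))]
      exact (div_pos (gaussianPDFReal_pos _ _ _ (hv i).ne')
        (gaussianPDFReal_pos _ _ _ (hV i).ne')).ne'
  have hsq : ∀ {X : EuclideanSpace ℝ 𝒳 × (Fin T → ℝ) → ℝ} {v : ℝ≥0}, Measurable X →
      (observationLaw μ S s l).map X = gaussianReal 0 v →
      Integrable (fun p => X p ^ 2) (observationLaw μ S s l) ∧
        ∫ p, X p ^ 2 ∂(observationLaw μ S s l) = v := by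
    intro X v hX hXv
    constructor
    · have := integrable_sq_gaussianReal v
      rw [← hXv, integrable_map_measure (by fun_prop) (by fun_prop)] at this
      exact this
    · rw [← integral_sq_gaussianReal v, ← hXv, integral_map (by fun_prop) (by fun_prop)]
  have hN := fun i => hsq (by fun_prop) (map_noise_observationLaw (μ := μ) (S := S) (s := s) l i)
  have hI := fun i => hsq (by fun_prop) (map_innovation_observationLaw (μ := μ) hS hs0 l i)
  have hint : ∀ i, Integrable (fun p : EuclideanSpace ℝ 𝒳 × (Fin T → ℝ) =>
      Real.log (predVar S s l i / (s i (l i) ^ 2 : ℝ≥0)) / 2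
        - (p.2 i - p.1 (l i)) ^ 2 / (2 * (s i (l i) ^ 2 : ℝ≥0))
        + (p.2 i - postMean μ S s l p.2 i (l i)) ^ 2 / (2 * predVar S s l i))
      (observationLaw μ S s l) := fun i =>
    ((integrable_const _).sub ((hN i).1.div_const _)).add ((hI i).1.div_const _)
  have hllr_int : Integrable (llr (observationLaw μ S s l) ν) (observationLaw μ S s l) :=
    (integrable_congr hllr).2 (integrable_finsetSum _ fun i _ => hint i)
  rw [mutualInformation, observationLaw_fst, observationLaw_snd hS hs0, ← hν,
    klDiv_of_ac_of_integrable hac hllr_int, integral_congr_ae hllr,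
    integral_finsetSum _ fun i _ => hint i]
  simp only [probReal_univ, add_sub_cancel_right]
  congr 1
  refine Finset.sum_congr rfl fun i _ => ?_
  have hN' : Integrable (fun p : EuclideanSpace ℝ 𝒳 × (Fin T → ℝ) =>
      Real.log (predVar S s l i / (s i (l i) ^ 2 : ℝ≥0)) / 2
        - (p.2 i - p.1 (l i)) ^ 2 / (2 * (s i (l i) ^ 2 : ℝ≥0))) (observationLaw μ S s l) :=
    (integrable_const _).sub ((hN i).1.div_const _)
  rw [integral_add hN' ((hI i).1.div_const _),
    integral_sub (integrable_const _) ((hN i).1.div_const _), integral_div, integral_div,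
    integral_div, (hN i).2, (hI i).2]
  have h1 : ((s i (l i) ^ 2 : ℝ≥0) : ℝ) ≠ 0 := by exact_mod_cast (hv i).ne'
  have h2 : (predVar S s l i : ℝ) ≠ 0 := by exact_mod_cast (hV i).ne'
  simp only [integral_const, probReal_univ, one_smul]
  field_simp
  ring

theorem maxInfoGain_ne_top (hS : S.PosSemidef) (hs0 : ∀ n a, 0 < s n a) :
    maxInfoGain μ S s ≠ ∞ := by
  rw [maxInfoGain, ← Finset.sup_univ_eq_iSup]
  refine ((Finset.sup_lt_iff (by simp)).2 fun l _ => ?_).ne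
  rw [mutualInformation_observationLaw hS hs0]
  exact ENNReal.ofReal_lt_top

theorem infoGain_le_maxInfoGain (hS : S.PosSemidef) (hs0 : ∀ n a, 0 < s n a) (l : Fin T → 𝒳) :
    infoGain S s l ≤ (maxInfoGain μ S s).toReal := by
  rw [← ENNReal.ofReal_le_iff_le_toReal (maxInfoGain_ne_top hS hs0),
    ← mutualInformation_observationLaw (μ := μ) hS hs0]
  exact le_iSup (fun l => mutualInformation (observationLaw μ S s l)) l

/-- The sum of the predictive variances along any sequence of locations is controlled by the
maximum information gain. -/
theorem sum_postCov_le (hS : S.PosSemidef) (hS1 : ∀ a, S a a ≤ 1) (hs0 : ∀ n a, 0 < s n a)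
    {σ : ℝ≥0} (hs : ∀ n a, s n a ≤ σ) (hσ : 0 < σ) (l : Fin T → 𝒳) :
    ∑ i : Fin T, postCov S s l i (l i) (l i)
      ≤ noiseConst σ * (maxInfoGain μ S s).toReal := by
  have hσ' : (0 : ℝ) < σ := hσ
  have hlog : 0 < Real.log (1 + ((σ : ℝ) ^ 2)⁻¹) := Real.log_pos (by
    have : (0 : ℝ) < ((σ : ℝ) ^ 2)⁻¹ := by positivity
    linarith)
  have hC : 0 ≤ noiseConst σ := div_nonneg zero_le_two hlog.le
  refine le_trans ?_ (mul_le_mul_of_nonneg_left (infoGain_le_maxInfoGain hS hs0 l) hC)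
  rw [infoGain, Finset.mul_sum]
  refine Finset.sum_le_sum fun i _ => ?_
  set k := postCov S s l i (l i) (l i) with hk
  have hk0 : 0 ≤ k := (posSemidef_postCov hS hs0 l i).diag_nonneg
  have hk1 : k ≤ 1 := (postCov_diag_le l i _).trans (hS1 _)
  have hsi : (0 : ℝ) < s i (l i) := hs0 _ _
  have hV : (predVar S s l i : ℝ) = k + (s i (l i) : ℝ) ^ 2 := by
    rw [predVar, coe_innovVar (posSemidef_postCov hS hs0 l i)]
    simp [hk]
  have e : (predVar S s l i / (s i (l i) ^ 2 : ℝ≥0) : ℝ) = 1 + k * ((s i (l i) : ℝ) ^ 2)⁻¹ := by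
    rw [hV]; push_cast; field_simp; ring
  -- Bernoulli's inequality `(1 + p) ^ k ≤ 1 + k p` for `k` in `[0, 1]`; this is where the bound on
  -- the prior variances enters. The actual noise level is then replaced through `s ≤ σ`.
  have hle : k * Real.log (1 + ((σ : ℝ) ^ 2)⁻¹)
      ≤ Real.log (1 + k * ((s i (l i) : ℝ) ^ 2)⁻¹) := by
    have hp : (0 : ℝ) < ((σ : ℝ) ^ 2)⁻¹ := by positivity
    rw [← Real.log_rpow (by positivity)]
    refine Real.log_le_log (by positivity) ?_
    refine (rpow_one_add_le_one_add_mul_self (by linarith) hk0 hk1).trans ?_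
    have : ((σ : ℝ) ^ 2)⁻¹ ≤ ((s i (l i) : ℝ) ^ 2)⁻¹ := by
      have := hs i (l i)
      gcongr
    gcongr
  rw [e, noiseConst, div_mul_div_comm, mul_comm (Real.log _) 2, mul_div_mul_left _ _ two_ne_zero]
  rwa [le_div_iff₀ hlog]

end InformationGain

/-! ### The posterior under adaptive sampling, on events with fixed past actions. -/

section Adaptive

/-- An event described by `Z` can be conditioned on without disturbing the law of `ε` or its
independence from functions of `Z`. -/
lemma map_restrict_prod_of_indepFun {Ω α β γ : Type*} [MeasurableSpace Ω] [MeasurableSpace α]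
    [MeasurableSpace β] [MeasurableSpace γ] {P : Measure Ω} [IsProbabilityMeasure P]
    {ε : Ω → α} {Z : Ω → β} (hε : Measurable ε) (hZ : Measurable Z) (h : IndepFun ε Z P)
    {C : Set β} (hC : MeasurableSet C) {f : β → γ} (hf : Measurable f) :
    (P.restrict (Z ⁻¹' C)).map (fun ω => (f (Z ω), ε ω))
      = ((P.restrict (Z ⁻¹' C)).map (fun ω => f (Z ω))).prod (P.map ε) := by
  have h1 : P.map (fun ω => (Z ω, ε ω)) = (P.map Z).prod (P.map ε) :=
    (indepFun_iff_map_prod_eq_prod_map_map hZ.aemeasurable hε.aemeasurable).1 h.symm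
  have := Measure.isProbabilityMeasure_map (μ := P) hε.aemeasurable
  have h2 : (P.restrict (Z ⁻¹' C)).map (fun ω => (Z ω, ε ω))
      = ((P.restrict (Z ⁻¹' C)).map Z).prod (P.map ε) := by
    rw [← Measure.restrict_map hZ hC]
    conv_rhs => rw [← Measure.restrict_univ (μ := P.map ε)]
    rw [Measure.prod_restrict, ← h1, Measure.restrict_map (hZ.prodMk hε) (hC.prod .univ)]
    congr 2
    ext ω; simp
  have h3 := congrArg (Measure.map (Prod.map f (id : α → α))) h2
  rw [← Measure.map_prod_map _ _ hf measurable_id, Measure.map_map (by fun_prop) (by fun_prop),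
    Measure.map_map hf hZ, Measure.map_id] at h3
  exact h3

variable {Ω : Type*} [MeasurableSpace Ω] {P : Measure Ω} [IsProbabilityMeasure P]
  {𝒳 : Type*} [Fintype 𝒳] [DecidableEq 𝒳] [MeasurableSpace 𝒳] [MeasurableSingletonClass 𝒳]
  {T : ℕ}

lemma measurable_apply_finite {α : Type*} [MeasurableSpace α] {f : Ω → 𝒳 → α}
    (hf : ∀ a, Measurable fun ω => f ω a) {x : Ω → 𝒳} (hx : Measurable x) :
    Measurable fun ω => f ω (x ω) := by
  have h : Measurable fun p : Ω × 𝒳 => f p.1 p.2 :=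
    measurable_from_prod_countable_left fun a => hf a
  exact h.comp (measurable_id.prodMk hx)

/-- The event that the actions of the first `t` rounds are those of `l`. -/
def actionEvent (x : Fin T → Ω → 𝒳) (l : Fin T → 𝒳) (t : ℕ) : Set Ω :=
  {ω | ∀ i : Fin T, (i : ℕ) < t → x i ω = l i}

lemma measurableSet_actionEvent {x : Fin T → Ω → 𝒳} (hx : ∀ n, Measurable (x n)) (l : Fin T → 𝒳)
    (t : ℕ) : MeasurableSet (actionEvent x l t) := by
  have : actionEvent x l t = ⋂ i : Fin T, ⋂ _ : (i : ℕ) < t, x i ⁻¹' {l i} := by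
    ext ω; simp [actionEvent]
  rw [this]
  exact .iInter fun i => .iInter fun _ => hx i (measurableSet_singleton _)

lemma actionEvent_succ (x : Fin T → Ω → 𝒳) (l : Fin T → 𝒳) (t : Fin T) :
    actionEvent x l (t + 1) = actionEvent x l t ∩ x t ⁻¹' {l t} := by
  ext ω
  simp only [actionEvent, Set.mem_ofPred_eq, Set.mem_inter_iff, Set.mem_preimage,
    Set.mem_singleton_iff]
  refine ⟨fun h => ⟨fun i hi => h i (by omega), h t (by omega)⟩, fun h i hi => ?_⟩
  rcases Nat.lt_succ_iff_lt_or_eq.1 hi with hi | hi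
  · exact h.1 i hi
  · obtain rfl := Fin.ext hi
    exact h.2

/-- The observations contained in a history, completed by zeros. -/
def historyObs (t : Fin T) (h : Set.Iio t → 𝒳 × ℝ) : Fin T → ℝ :=
  fun i => if hi : i < t then (h ⟨i, hi⟩).2 else 0

/-- The history with actions `l` and observations `Y`. -/
def historyOf (t : Fin T) (l : Fin T → 𝒳) (Y : Fin T → ℝ) : Set.Iio t → 𝒳 × ℝ :=
  fun i => (l i, Y i)

@[fun_prop]
lemma measurable_historyObs (t : Fin T) : Measurable (historyObs (𝒳 := 𝒳) t) := by
  refine measurable_pi_lambda _ fun i => ?_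
  unfold historyObs
  split_ifs <;> fun_prop

@[fun_prop]
lemma measurable_historyOf (t : Fin T) (l : Fin T → 𝒳) : Measurable (historyOf t l) := by
  unfold historyOf; fun_prop

lemma historyObs_history (x : Fin T → Ω → 𝒳) (y : Fin T → Ω → ℝ) (t : Fin T) (ω : Ω) :
    historyObs t (history x y t ω) = trunc t (fun i => y i ω) := by
  ext i
  by_cases hi : i < t
  · have : (i : ℕ) < t := hi
    simp [historyObs, history, trunc, hi]
  · have : ¬ (i : ℕ) < t := hi
    simp [historyObs, trunc, hi]

lemma historyOf_trunc {x : Fin T → Ω → 𝒳} (y : Fin T → Ω → ℝ) {t : Fin T} {l : Fin T → 𝒳} {ω : Ω}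
    (hω : ω ∈ actionEvent x l t) :
    historyOf t l (trunc t (fun i => y i ω)) = history x y t ω := by
  ext i
  · exact (hω i i.2).symm
  · have : ((i : Fin T) : ℕ) < t := i.2
    simp [historyOf, history, trunc, this]

lemma measurable_history {x : Fin T → Ω → 𝒳} {y : Fin T → Ω → ℝ} (hx : ∀ n, Measurable (x n))
    (hy : ∀ n, Measurable (y n)) (t : Fin T) : Measurable (history x y t) :=
  measurable_pi_lambda _ fun i => (hx i).prodMk (hy i)

variable {μ : EuclideanSpace ℝ 𝒳} {S : Matrix 𝒳 𝒳 ℝ} {s : Fin T → 𝒳 → ℝ≥0}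

/-- Restricting to an event whose conditional probability given a finer σ-algebra is a function `φ`
of `h` amounts to weighting the law by `φ`. -/
lemma map_restrict_inter_eq_withDensity {β γ : Type*} [MeasurableSpace β] [MeasurableSpace γ]
    {Z : Ω → β} (hZ : Measurable Z) {C : Set β} (hC : MeasurableSet C)
    {f : β → γ} (hf : Measurable f) {A : Set Ω} (hA : MeasurableSet A) {g : γ → ℝ}
    (hg : Measurable g)
    (hgA : ∀ᵐ ω ∂P, ω ∈ Z ⁻¹' C → (P⟦A | sigmaOf Z⟧) ω = g (f (Z ω))) :
    (P.restrict (Z ⁻¹' C ∩ A)).map (fun ω => f (Z ω))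
      = ((P.restrict (Z ⁻¹' C)).map (fun ω => f (Z ω))).withDensity
          fun p => ENNReal.ofReal (g p) := by
  have hm : sigmaOf Z ≤ ‹MeasurableSpace Ω› := hZ.comap_le
  have hfZ : Measurable fun ω => f (Z ω) := hf.comp hZ
  refine Measure.ext fun D hD => ?_
  rw [Measure.map_apply hfZ hD, withDensity_apply _ hD, setLIntegral_map hD (by fun_prop) hfZ,
    Measure.restrict_apply (hfZ hD), Measure.restrict_restrict (hfZ hD)]
  set G : Set Ω := (fun ω => f (Z ω)) ⁻¹' D ∩ Z ⁻¹' C with hG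
  have hGm : MeasurableSet[sigmaOf Z] G := ⟨f ⁻¹' D ∩ C, (hf hD).inter hC, rfl⟩
  have hGm' : MeasurableSet G := hm _ hGm
  have hint : Integrable (A.indicator fun _ => (1 : ℝ)) P := (integrable_const _).indicator hA
  have h1 : ∫ ω in G, (P⟦A | sigmaOf Z⟧) ω ∂P = P.real (G ∩ A) := by
    rw [setIntegral_condExp hm hint hGm]
    refine (integral_indicator_one hA).trans ?_
    rw [measureReal_restrict_apply hA, Set.inter_comm]
  have h2 : ∫⁻ ω in G, ENNReal.ofReal (g (f (Z ω))) ∂P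
      = ∫⁻ ω in G, ENNReal.ofReal ((P⟦A | sigmaOf Z⟧) ω) ∂P := by
    refine setLIntegral_congr_fun_ae hGm' ?_
    filter_upwards [hgA] with ω hω hωG
    rw [hω hωG.2]
  rw [h2, ← ofReal_integral_eq_lintegral_ofReal integrable_condExp.integrableOn
    (ae_restrict_of_ae (condExp_nonneg (.of_forall fun ω => Set.indicator_nonneg (by simp) ω))),
    h1, ofReal_measureReal]
  rw [hG, Set.inter_assoc]

/-- Along an adaptive sampling process, on the event that the actions of the first `t` rounds are
those of `l`, the residual of the observable rewards is Gaussian with the posterior covariance, and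
is independent of the hidden rewards and the observations, which are themselves independent. -/
theorem exists_map_residual_actionEvent
    (hS : S.PosSemidef) (hs0 : ∀ n a, 0 < s n a)
    {rObs : Ω → EuclideanSpace ℝ 𝒳} (hrObs_meas : Measurable rObs)
    (hrObs : HasLaw rObs (multivariateGaussian μ S) P)
    {rHid : Ω → 𝒳 → ℝ} (hrHid_meas : Measurable rHid) (hindep : IndepFun rObs rHid P)
    {x : Fin T → Ω → 𝒳} (hx_meas : ∀ n, Measurable (x n))
    {η : Fin T → 𝒳 → Ω → ℝ} (hη_meas : ∀ n a, Measurable (η n a))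
    {y : Fin T → Ω → ℝ} (hy_meas : ∀ n, Measurable (y n))
    (hy : ∀ n ω, y n ω = rObs ω (x n ω) + η n (x n ω) ω)
    (hη : ∀ n a, HasLaw (η n a) (gaussianReal 0 (s n a ^ 2)) P)
    (hη_indep : ∀ n, IndepFun (fun ω a => η n a ω)
      (fun ω => (rObs ω, rHid ω, history x y n ω, x n ω)) P)
    {B : 𝒳 → Set Ω}
    (hx : ∀ (n : Fin T) (a : 𝒳),
      P⟦x n ⁻¹' {a} | sigmaOf (fun ω => (rObs ω, rHid ω, history x y n ω))⟧
        =ᵐ[P] P⟦B a | sigmaOf (history x y n)⟧)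
    (l : Fin T → 𝒳) {t : ℕ} (ht : t ≤ T) :
    ∃ ν : Measure (Fin T → ℝ), SFinite ν ∧
      (P.restrict (actionEvent x l t)).map (fun ω => (rObs ω - postMean μ S s l (fun i => y i ω) t,
          rHid ω, trunc t (fun i => y i ω)))
        = (multivariateGaussian 0 (postCov S s l t)).prod ((P.map rHid).prod ν) := by
  have hym : Measurable fun ω i => y i ω := measurable_pi_lambda _ hy_meas
  have hHprob := Measure.isProbabilityMeasure_map (μ := P) hrHid_meas.aemeasurable
  induction t with
  | zero =>
    refine ⟨Measure.dirac 0, inferInstance, ?_⟩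
    have h0 : actionEvent x l 0 = Set.univ := by ext; simp [actionEvent]
    have h1 := (indepFun_iff_map_prod_eq_prod_map_map hrObs_meas.aemeasurable
      hrHid_meas.aemeasurable).1 hindep
    rw [hrObs.map_eq] at h1
    simp only [h0, Measure.restrict_univ, postMean, trunc_zero, postCov]
    rw [← map_sub_multivariateGaussian (μ := μ) hS, Measure.prod_dirac,
      Measure.map_prod_map _ _ (by fun_prop) (by fun_prop), ← h1,
      Measure.map_map (by fun_prop) (by fun_prop)]
    rfl
  | succ t ih =>
    obtain ⟨t, rfl⟩ : ∃ u : Fin T, (u : ℕ) = t := ⟨⟨t, ht⟩, rfl⟩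
    obtain ⟨ν, hν, hM⟩ := ih (by omega)
    have hist_m := measurable_history hx_meas hy_meas t
    -- The probability of playing `l t` is a function `φ` of the history alone. This is the only
    -- feature of Thompson sampling used in this induction.
    obtain ⟨φ, hφ, hφq⟩ : ∃ φ : (Set.Iio t → 𝒳 × ℝ) → ℝ, Measurable φ ∧
        P⟦B (l t) | sigmaOf (history x y t)⟧ = φ ∘ history x y t := by
      have : StronglyMeasurable[sigmaOf (history x y t)] (P⟦B (l t) | sigmaOf (history x y t)⟧) :=
        stronglyMeasurable_condExp
      exact this.measurable.exists_eq_measurable_comp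
    let ρof : EuclideanSpace ℝ 𝒳 × (𝒳 → ℝ) × (Set.Iio t → 𝒳 × ℝ) →
        EuclideanSpace ℝ 𝒳 × (𝒳 → ℝ) × (Fin T → ℝ) := fun p =>
      (p.1 - postMean μ S s l (historyObs t p.2.2) t, p.2.1, historyObs t p.2.2)
    have hρof : Measurable ρof := by
      have : Measurable fun p : EuclideanSpace ℝ 𝒳 × (𝒳 → ℝ) × (Set.Iio t → 𝒳 × ℝ) =>
        postMean μ S s l (historyObs t p.2.2) t := (measurable_postMean l t).comp (by fun_prop)
      fun_prop
    have hρeq : ∀ ω, ρof (rObs ω, rHid ω, history x y t ω)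
        = (rObs ω - postMean μ S s l (fun i => y i ω) t, rHid ω, trunc t (fun i => y i ω)) := by
      intro ω
      simp only [ρof, historyObs_history, postMean_trunc l _ le_rfl]
    let C : Set (EuclideanSpace ℝ 𝒳 × (𝒳 → ℝ) × (Set.Iio t → 𝒳 × ℝ)) :=
      {p | ∀ i : Set.Iio t, (p.2.2 i).1 = l i}
    have hC : MeasurableSet C := by
      have : C = ⋂ i : Set.Iio t, (fun p => (p.2.2 i).1) ⁻¹' {l i} := by ext; simp [C]
      rw [this]
      exact .iInter fun i => (by fun_prop : Measurable fun p : EuclideanSpace ℝ 𝒳 × (𝒳 → ℝ) ×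
        (Set.Iio t → 𝒳 × ℝ) => (p.2.2 i).1) (measurableSet_singleton _)
    have hCE : (fun ω => (rObs ω, rHid ω, history x y t ω)) ⁻¹' C = actionEvent x l t := by
      ext ω
      simp only [C, history, actionEvent, Set.mem_preimage, Set.mem_ofPred_eq, Subtype.forall,
        Set.mem_Iio, Fin.lt_def]
    have hZ : Measurable fun ω => (rObs ω, rHid ω, history x y t ω) := by fun_prop
    have hA : MeasurableSet (x t ⁻¹' {l t}) := hx_meas t (measurableSet_singleton _)
    -- On the event the past actions are fixed, so `φ` depends only on the observations. The
    -- reweighting is absorbed into `ν`, which is why `ν` is left unspecified in the statement.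
    have hdens : (P.restrict (actionEvent x l (t + 1))).map
          (fun ω => (rObs ω - postMean μ S s l (fun i => y i ω) t, rHid ω,
            trunc t (fun i => y i ω)))
        = (multivariateGaussian 0 (postCov S s l t)).prod ((P.map rHid).prod
            (ν.withDensity fun Y => ENNReal.ofReal (φ (historyOf t l Y)))) := by
      have h := map_restrict_inter_eq_withDensity (P := P) hZ hC hρof hA
        (g := fun p => φ (historyOf t l p.2.2)) (by fun_prop) (by
          filter_upwards [hx t (l t)] with ω hω hωC
          rw [hω, hφq, hρeq]
          have : ω ∈ actionEvent x l t := by rw [← hCE]; exact hωC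
          simp [historyOf_trunc y this])
      simp only [hρeq, hCE] at h
      rw [actionEvent_succ, h, hM, prod_withDensity_right (by fun_prop),
        prod_withDensity_right (g := fun q : (𝒳 → ℝ) × (Fin T → ℝ) =>
          ENNReal.ofReal (φ (historyOf t l q.2))) (by fun_prop)]
    -- The event now also fixes the current action, so independence of the noise from `x t` is
    -- needed along with independence from the past.
    have hnoise : (P.restrict (actionEvent x l (t + 1))).map
          (fun ω => ((rObs ω - postMean μ S s l (fun i => y i ω) t, rHid ω,
            trunc t (fun i => y i ω)), η t (l t) ω))
        = ((P.restrict (actionEvent x l (t + 1))).map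
          (fun ω => (rObs ω - postMean μ S s l (fun i => y i ω) t, rHid ω,
            trunc t (fun i => y i ω)))).prod (gaussianReal 0 (s t (l t) ^ 2)) := by
      have hev : Measurable fun e : 𝒳 → ℝ => e (l t) := measurable_pi_apply _
      have hi := (hη_indep t).comp hev measurable_id
      let C' : Set (EuclideanSpace ℝ 𝒳 × (𝒳 → ℝ) × (Set.Iio t → 𝒳 × ℝ) × 𝒳) :=
        (fun p => (p.1, p.2.1, p.2.2.1)) ⁻¹' C ∩ (fun p => p.2.2.2) ⁻¹' {l t}
      have hC' : MeasurableSet C' :=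
        ((by fun_prop : Measurable fun p : EuclideanSpace ℝ 𝒳 × (𝒳 → ℝ) ×
          (Set.Iio t → 𝒳 × ℝ) × 𝒳 => (p.1, p.2.1, p.2.2.1)) hC).inter
        ((by fun_prop : Measurable fun p : EuclideanSpace ℝ 𝒳 × (𝒳 → ℝ) ×
          (Set.Iio t → 𝒳 × ℝ) × 𝒳 => p.2.2.2) (measurableSet_singleton _))
      have hCE' : (fun ω => (rObs ω, rHid ω, history x y t ω, x t ω)) ⁻¹' C'
          = actionEvent x l (t + 1) := by
        rw [actionEvent_succ, ← hCE]; rfl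
      have h := map_restrict_prod_of_indepFun (P := P) (hη_meas t (l t))
        (Z := fun ω => (rObs ω, rHid ω, history x y t ω, x t ω)) (by fun_prop) hi hC'
        (f := fun p => ρof (p.1, p.2.1, p.2.2.1)) (by fun_prop)
      simp only [hρeq, hCE', (hη t (l t)).map_eq] at h
      exact h
    refine ⟨_, ?_, map_residual_succ hS hs0 l t hrObs_meas hrHid_meas hym (hη_meas t (l t))
      hdens hnoise ?_⟩
    · infer_instance
    · refine (ae_restrict_iff' (measurableSet_actionEvent hx_meas l _)).2 (.of_forall fun ω hω => ?_)
      have : x t ω = l t := hω t (Nat.lt_succ_self _)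
      rw [hy, this]

end Adaptive

/-! ### Gluing the events with fixed past actions. -/

section Adaptive

variable {Ω : Type*} [MeasurableSpace Ω] {P : Measure Ω} [IsProbabilityMeasure P]
  {𝒳 : Type*} [Fintype 𝒳] [DecidableEq 𝒳] [MeasurableSpace 𝒳] [MeasurableSingletonClass 𝒳]
  {T : ℕ} {μ : EuclideanSpace ℝ 𝒳} {S : Matrix 𝒳 𝒳 ℝ} {s : Fin T → 𝒳 → ℝ≥0}

/-- The actions of the first `t` rounds, completed by a fixed action. -/
def truncActions (a₀ : 𝒳) (x : Fin T → Ω → 𝒳) (t : ℕ) (ω : Ω) : Fin T → 𝒳 :=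
  fun i => if (i : ℕ) < t then x i ω else a₀

lemma measurable_truncActions (a₀ : 𝒳) {x : Fin T → Ω → 𝒳} (hx : ∀ n, Measurable (x n)) (t : ℕ) :
    Measurable (truncActions a₀ x t) := by
  refine measurable_pi_lambda _ fun i => ?_
  unfold truncActions
  split_ifs
  · exact hx i
  · exact measurable_const

/-- The truncated action sequence takes finitely many values, so its fibres partition the space. A
nonempty fibre forces `l` to equal `a₀` from index `t` on and is then an action event. -/
lemma restrict_truncActions (a₀ : 𝒳) (x : Fin T → Ω → 𝒳) (t : ℕ) (l : Fin T → 𝒳) :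
    P.restrict (truncActions a₀ x t ⁻¹' {l}) = 0 ∨
      truncActions a₀ x t ⁻¹' {l} = actionEvent x l t := by
  rcases (truncActions a₀ x t ⁻¹' {l}).eq_empty_or_nonempty with h | ⟨ω₀, h₀⟩
  · left; simp [h]
  · right
    have h₀' : truncActions a₀ x t ω₀ = l := h₀
    ext ω
    simp only [Set.mem_preimage, Set.mem_singleton_iff, actionEvent, Set.mem_ofPred_eq]
    refine ⟨fun h i hi => ?_, fun h => ?_⟩
    · rw [← h]; simp [truncActions, hi]
    · ext i
      by_cases hi : (i : ℕ) < t
      · rw [← h i hi]; simp [truncActions, hi]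
      · rw [← h₀']; simp [truncActions, hi]

lemma eq_sum_restrict_fiber {β : Type*} [Fintype β] [MeasurableSpace β]
    [MeasurableSingletonClass β] {L : Ω → β} (hL : Measurable L) :
    P = ∑ l, P.restrict (L ⁻¹' {l}) := by
  have h := Measure.restrict_iUnion (μ := P) (s := fun l => L ⁻¹' {l})
    (fun i j hij => Set.disjoint_left.2 fun ω hi hj => hij (hi.symm.trans hj))
    fun l => hL (measurableSet_singleton l)
  have hu : ⋃ l, L ⁻¹' {l} = Set.univ := by ext; simp
  rw [hu, Measure.restrict_univ, Measure.sum_fintype] at h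
  exact h

/-- Integrals over an adaptive sampling process of functions of the history, the residual and the
hidden rewards: given the history, the residual is Gaussian with the posterior covariance, and the
hidden rewards are independent of it and of the history. -/
theorem integral_history_mul_residual
    {rObs : Ω → EuclideanSpace ℝ 𝒳} (hrObs_meas : Measurable rObs)
    {rHid : Ω → 𝒳 → ℝ} (hrHid_meas : Measurable rHid)
    {x : Fin T → Ω → 𝒳} (hx_meas : ∀ n, Measurable (x n))
    {y : Fin T → Ω → ℝ} (hy_meas : ∀ n, Measurable (y n)) (n : Fin T)
    (hInv : ∀ l, ∃ ν : Measure (Fin T → ℝ), SFinite ν ∧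
      (P.restrict (actionEvent x l n)).map (fun ω => (rObs ω - postMean μ S s l (fun i => y i ω) n,
          rHid ω, trunc n (fun i => y i ω)))
        = (multivariateGaussian 0 (postCov S s l n)).prod ((P.map rHid).prod ν))
    {f : (Fin T → 𝒳) → EuclideanSpace ℝ 𝒳 → (𝒳 → ℝ) → ℝ} {c : (Fin T → 𝒳) → ℝ}
    (hf : ∀ l, Measurable fun q : EuclideanSpace ℝ 𝒳 × (𝒳 → ℝ) => f l q.1 q.2)
    (hfl : ∀ l l', (∀ i : Fin T, (i : ℕ) < n → l i = l' i) → f l = f l')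
    (hcl : ∀ l l', (∀ i : Fin T, (i : ℕ) < n → l i = l' i) → c l = c l')
    (hfint : ∀ l, Integrable (fun q : EuclideanSpace ℝ 𝒳 × (𝒳 → ℝ) => f l q.1 q.2)
      ((multivariateGaussian 0 (postCov S s l n)).prod (P.map rHid)))
    (hfc : ∀ l, ∫ q, f l q.1 q.2 ∂((multivariateGaussian 0 (postCov S s l n)).prod (P.map rHid))
      = c l)
    {ψ : (Set.Iio n → 𝒳 × ℝ) → ℝ} (hψ : Measurable ψ) {b : ℝ} (hψb : ∀ h, |ψ h| ≤ b) :
    Integrable (fun ω => ψ (history x y n ω) * f (fun i => x i ω)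
      (rObs ω - postMean μ S s (fun i => x i ω) (fun i => y i ω) n) (rHid ω)) P ∧
    ∫ ω, ψ (history x y n ω) * f (fun i => x i ω)
      (rObs ω - postMean μ S s (fun i => x i ω) (fun i => y i ω) n) (rHid ω) ∂P
      = ∫ ω, ψ (history x y n ω) * c (fun i => x i ω) ∂P := by
  have hHprob := Measure.isProbabilityMeasure_map (μ := P) hrHid_meas.aemeasurable
  have hym : Measurable fun ω i => y i ω := measurable_pi_lambda _ hy_meas
  have hist_m := measurable_history hx_meas hy_meas n
  -- the statement on each event with fixed actions
  have key : ∀ l, (Integrable (fun ω => ψ (history x y n ω) * f (fun i => x i ω)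
      (rObs ω - postMean μ S s (fun i => x i ω) (fun i => y i ω) n) (rHid ω))
        (P.restrict (actionEvent x l n)) ∧
      Integrable (fun ω => ψ (history x y n ω) * c (fun i => x i ω))
        (P.restrict (actionEvent x l n))) ∧
    ∫ ω in actionEvent x l n, ψ (history x y n ω) * f (fun i => x i ω)
      (rObs ω - postMean μ S s (fun i => x i ω) (fun i => y i ω) n) (rHid ω) ∂P
      = ∫ ω in actionEvent x l n, ψ (history x y n ω) * c (fun i => x i ω) ∂P := by
    intro l
    obtain ⟨ν, hν, hM⟩ := hInv l
    have hE := measurableSet_actionEvent hx_meas l n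
    set N := multivariateGaussian 0 (postCov S s l n)
    have hpm : Measurable fun ω => postMean μ S s l (fun i => y i ω) n :=
      (measurable_postMean l n).comp hym
    have hgm : Measurable fun ω => (rObs ω - postMean μ S s l (fun i => y i ω) n,
          rHid ω, trunc n (fun i => y i ω)) := by fun_prop
    -- The other two factors are probability measures, so the mass of `ν` is that of the event.
    have hνfin : IsFiniteMeasure ν := by
      have h := congrArg (fun m => m Set.univ) hM
      simp only [Measure.map_apply hgm .univ] at h
      rw [← Set.univ_prod_univ, Measure.prod_prod, ← Set.univ_prod_univ, Measure.prod_prod,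
        measure_univ, measure_univ, one_mul, one_mul] at h
      exact ⟨h ▸ measure_lt_top _ _⟩
    have e1 : (fun ω => ψ (history x y n ω) * f (fun i => x i ω)
        (rObs ω - postMean μ S s (fun i => x i ω) (fun i => y i ω) n) (rHid ω))
        =ᵐ[P.restrict (actionEvent x l n)] (fun q : EuclideanSpace ℝ 𝒳 × (𝒳 → ℝ) × (Fin T → ℝ) =>
          ψ (historyOf n l q.2.2) * f l q.1 q.2.1) ∘ fun ω =>
          (rObs ω - postMean μ S s l (fun i => y i ω) n, rHid ω, trunc n (fun i => y i ω)) := by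
      refine (ae_restrict_iff' hE).2 (.of_forall fun ω hω => ?_)
      simp only [Function.comp_apply, historyOf_trunc y hω, hfl (fun i => x i ω) l hω,
        postMean_congr (l := fun i => x i ω) (l' := l) hω fun _ _ => rfl]
    have e2 : (fun ω => ψ (history x y n ω) * c (fun i => x i ω))
        =ᵐ[P.restrict (actionEvent x l n)] (fun q : EuclideanSpace ℝ 𝒳 × (𝒳 → ℝ) × (Fin T → ℝ) =>
          ψ (historyOf n l q.2.2) * c l) ∘ fun ω =>
          (rObs ω - postMean μ S s l (fun i => y i ω) n, rHid ω, trunc n (fun i => y i ω)) := by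
      refine (ae_restrict_iff' hE).2 (.of_forall fun ω hω => ?_)
      simp only [Function.comp_apply, historyOf_trunc y hω, hcl (fun i => x i ω) l hω]
    have hfl_m := hf l
    have m1 : Measurable fun q : EuclideanSpace ℝ 𝒳 × (𝒳 → ℝ) × (Fin T → ℝ) =>
        ψ (historyOf n l q.2.2) * f l q.1 q.2.1 := by
      have : Measurable fun q : EuclideanSpace ℝ 𝒳 × (𝒳 → ℝ) × (Fin T → ℝ) => f l q.1 q.2.1 :=
        hfl_m.comp (by fun_prop : Measurable fun q : EuclideanSpace ℝ 𝒳 × (𝒳 → ℝ) × (Fin T → ℝ) =>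
          (q.1, q.2.1))
      fun_prop
    have m2 : Measurable fun q : EuclideanSpace ℝ 𝒳 × (𝒳 → ℝ) × (Fin T → ℝ) =>
        ψ (historyOf n l q.2.2) * c l := by fun_prop
    have hψi : Integrable (fun Y => ψ (historyOf n l Y)) ν :=
      Integrable.of_bound (Measurable.aestronglyMeasurable (by fun_prop)) b (.of_forall fun Y => hψb _)
    have a1 : Measure.map (MeasurableEquiv.prodAssoc (α := EuclideanSpace ℝ 𝒳) (β := 𝒳 → ℝ)
        (γ := Fin T → ℝ)) ((N.prod (P.map rHid)).prod ν) = N.prod ((P.map rHid).prod ν) :=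
      Measure.prodAssoc_prod
    have i1 : Integrable (fun q : EuclideanSpace ℝ 𝒳 × (𝒳 → ℝ) × (Fin T → ℝ) =>
        ψ (historyOf n l q.2.2) * f l q.1 q.2.1) (N.prod ((P.map rHid).prod ν)) := by
      rw [← a1, integrable_map_equiv]
      refine ((hfint l).mul_prod hψi).congr (.of_forall fun q => ?_)
      simp [MeasurableEquiv.prodAssoc, mul_comm]
    have i2 : Integrable (fun q : EuclideanSpace ℝ 𝒳 × (𝒳 → ℝ) × (Fin T → ℝ) =>
        ψ (historyOf n l q.2.2) * c l) (N.prod ((P.map rHid).prod ν)) :=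
      Integrable.of_bound m2.aestronglyMeasurable (b * |c l|) (.of_forall fun q => by
        rw [Real.norm_eq_abs, abs_mul]
        exact mul_le_mul_of_nonneg_right (hψb _) (abs_nonneg _))
    refine ⟨⟨?_, ?_⟩, ?_⟩
    · rw [integrable_congr e1, ← integrable_map_measure (by fun_prop) (by fun_prop), hM]
      exact i1
    · rw [integrable_congr e2, ← integrable_map_measure m2.aestronglyMeasurable (by fun_prop), hM]
      exact i2
    · rw [integral_congr_ae e1, integral_congr_ae e2]
      simp only [Function.comp_def]
      rw [← integral_map (φ := fun ω => (rObs ω - postMean μ S s l (fun i => y i ω) n,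
          rHid ω, trunc n (fun i => y i ω))) (f := fun q : EuclideanSpace ℝ 𝒳 × (𝒳 → ℝ) ×
          (Fin T → ℝ) => ψ (historyOf n l q.2.2) * f l q.1 q.2.1) (by fun_prop) (by fun_prop),
        ← integral_map (φ := fun ω => (rObs ω - postMean μ S s l (fun i => y i ω) n,
          rHid ω, trunc n (fun i => y i ω))) (f := fun q : EuclideanSpace ℝ 𝒳 × (𝒳 → ℝ) ×
          (Fin T → ℝ) => ψ (historyOf n l q.2.2) * c l) (by fun_prop)
          m2.aestronglyMeasurable, hM, ← a1,
        integral_map_equiv, integral_map_equiv]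
      have p1 := integral_prod_mul (μ := N.prod (P.map rHid)) (ν := ν)
        (fun q => f l q.1 q.2) (fun Y => ψ (historyOf n l Y))
      have p2 := integral_prod_mul (μ := N.prod (P.map rHid)) (ν := ν)
        (fun _ => c l) (fun Y => ψ (historyOf n l Y))
      rw [hfc] at p1
      simp only [integral_const, probReal_univ, one_smul] at p2
      refine Eq.trans ?_ ((p1.trans p2.symm).trans ?_)
      · exact integral_congr_ae (.of_forall fun q => mul_comm _ _)
      · exact integral_congr_ae (.of_forall fun q => mul_comm _ _)
  -- A default action is needed to complete truncated sequences; without any action the probability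
  -- space would be empty.
  rcases isEmpty_or_nonempty 𝒳 with h𝒳 | ⟨⟨a₀⟩⟩
  · have : IsEmpty Ω := ⟨fun ω => h𝒳.elim (x n ω)⟩
    exact absurd (Measure.eq_zero_of_isEmpty P) (IsProbabilityMeasure.ne_zero P)
  have hfib := eq_sum_restrict_fiber (P := P) (measurable_truncActions a₀ hx_meas n)
  have hcase := restrict_truncActions (P := P) a₀ x n
  have hF : ∀ l ∈ Finset.univ, Integrable (fun ω => ψ (history x y n ω) * f (fun i => x i ω)
      (rObs ω - postMean μ S s (fun i => x i ω) (fun i => y i ω) n) (rHid ω))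
        (P.restrict (truncActions a₀ x n ⁻¹' {l})) := fun l _ => by
    rcases hcase l with h | h
    · rw [h]; exact integrable_zero_measure
    · rw [h]; exact (key l).1.1
  have hC : ∀ l ∈ Finset.univ, Integrable (fun ω => ψ (history x y n ω) * c (fun i => x i ω))
        (P.restrict (truncActions a₀ x n ⁻¹' {l})) := fun l _ => by
    rcases hcase l with h | h
    · rw [h]; exact integrable_zero_measure
    · rw [h]; exact (key l).1.2
  rw [hfib, integrable_finsetSum_measure, integral_finsetSum_measure hF,
    integral_finsetSum_measure hC]
  refine ⟨hF, Finset.sum_congr rfl fun l _ => ?_⟩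
  rcases hcase l with h | h
  · rw [h]; simp
  · rw [h]; exact (key l).2

end Adaptive

/-! ### Scalar inequalities and conditional probabilities. -/

section Auxiliary

/-- Trivial for `|z| ≤ √t`. Otherwise put `d = √t (|z| - √t)`: since `t ≥ 1`, `z ^ 2 ≤ t + 2 d + d ^
2`, and `2 + 2 d + d ^ 2 ≤ 2 exp d`, where `exp d = exp (-t) * exp (√t |z|)`. It turns a maximum of
squares into a sum of exponential moments. -/
lemma sq_le_add_cosh {t : ℝ} (ht : 1 ≤ t) (z : ℝ) :
    z ^ 2 ≤ t + 4 * Real.exp (-t) * Real.cosh (√t * z) := by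
  have ht0 : 0 ≤ t := by linarith
  have hc : Real.cosh (√t * z) = Real.cosh (√t * |z|) := by
    rw [← Real.cosh_abs (√t * z), abs_mul, abs_of_nonneg (Real.sqrt_nonneg t)]
  rw [hc, ← sq_abs]
  have hz := abs_nonneg z
  set w := |z|
  have hr := Real.sqrt_nonneg t
  have hrt := Real.sq_sqrt ht0
  set r := √t
  have hcosh : Real.exp (r * w) / 2 ≤ Real.cosh (r * w) := by
    rw [Real.cosh_eq]
    have := Real.exp_pos (-(r * w))
    linarith
  have hexp := Real.exp_pos (-t)
  rcases le_or_gt w r with h | h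
  · have : w ^ 2 ≤ r ^ 2 := by gcongr
    have := Real.cosh_pos (r * w)
    have : 0 ≤ 4 * Real.exp (-t) * Real.cosh (r * w) := by positivity
    linarith
  · have hd : 0 ≤ r * (w - r) := mul_nonneg hr (by linarith)
    have h1 := Real.quadratic_le_exp_of_nonneg hd
    have h2 : Real.exp (-t) * Real.exp (r * w) = Real.exp (r * (w - r)) := by
      rw [← Real.exp_add]; congr 1; linear_combination hrt
    have h3 : 2 * Real.exp (r * (w - r)) ≤ 4 * Real.exp (-t) * Real.cosh (r * w) := by
      calc 2 * Real.exp (r * (w - r)) = 4 * Real.exp (-t) * (Real.exp (r * w) / 2) := by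
            rw [← h2]; ring
        _ ≤ _ := by gcongr
    have h4 : (w - r) ^ 2 ≤ (r * (w - r)) ^ 2 := by
      rw [mul_pow, hrt]; exact le_mul_of_one_le_left (sq_nonneg _) ht
    have : w ^ 2 = t + 2 * (r * (w - r)) + (w - r) ^ 2 := by rw [← hrt]; ring
    linarith

lemma le_sqrt_of_forall_le {R G B : ℝ} (hG : 0 ≤ G) (hB : 0 ≤ B)
    (h : ∀ c > 0, R ≤ (c * G + B / c) / 2) : R ≤ √(G * B) := by
  rcases hG.eq_or_lt with rfl | hG
  · rw [zero_mul, Real.sqrt_zero]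
    by_contra! hR
    -- With `G = 0` this choice gives `R ≤ R * B / (2 (B + 1))`, impossible for `R > 0`.
    have := h ((B + 1) / R) (by positivity)
    rw [mul_zero, zero_add, div_div_eq_mul_div, div_div, le_div_iff₀ (by positivity)] at this
    nlinarith
  rcases hB.eq_or_lt with rfl | hB
  · rw [mul_zero, Real.sqrt_zero]
    by_contra! hR
    -- With `B = 0` this choice gives `R ≤ R / 2`.
    have := h (R / G) (by positivity)
    rw [div_mul_cancel₀ _ hG.ne'] at this
    simp at this
    linarith
  · have hg := Real.sqrt_pos.2 hG
    have hb := Real.sqrt_pos.2 hB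
    -- The minimizer of the right-hand side over `c`.
    have := h (√B / √G) (by positivity)
    rw [Real.sqrt_mul hG.le]
    have e1 := Real.sq_sqrt hG.le
    have e2 := Real.sq_sqrt hB.le
    refine this.trans (le_of_eq ?_)
    conv_lhs => rw [← e1, ← e2]
    rw [Real.sqrt_sq hg.le, Real.sqrt_sq hb.le]
    field_simp
    ring

lemma integral_cosh_gaussianReal_le (u : ℝ) (v : ℝ≥0) :
    Integrable (fun x => Real.cosh (u * (x / √v))) (gaussianReal 0 v) ∧
      ∫ x, Real.cosh (u * (x / √v)) ∂(gaussianReal 0 v) ≤ Real.exp (u ^ 2 / 2) := by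
  have e : (fun x : ℝ => Real.cosh (u * (x / √v)))
      = fun x => (Real.exp (u / √v * x) + Real.exp (-(u / √v) * x)) / 2 := by
    ext x
    rw [Real.cosh_eq]
    congr 3 <;> ring_nf
  have hi : ∀ w : ℝ, Integrable (fun x => Real.exp (w * x)) (gaussianReal 0 v) := fun w =>
    integrable_exp_mul_gaussianReal w
  have hI : ∀ w : ℝ, ∫ x, Real.exp (w * x) ∂(gaussianReal 0 v) = Real.exp (v * w ^ 2 / 2) := by
    intro w
    have := congrFun (mgf_id_gaussianReal (μ := 0) (v := v)) w
    simpa [mgf] using this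
  -- Equality for `v ≠ 0`; for `v = 0` division by zero makes the left side vanish.
  have hle : (v : ℝ) * (u / √v) ^ 2 ≤ u ^ 2 := by
    rw [div_pow, Real.sq_sqrt v.coe_nonneg]
    rcases eq_or_ne (v : ℝ) 0 with h | h
    · rw [h]; simp; positivity
    · rw [mul_div_cancel₀ _ h]
  rw [e]
  refine ⟨((hi _).add (hi _)).div_const _, ?_⟩
  rw [integral_div, integral_add (hi _) (hi _), hI, hI, neg_sq, add_self_div_two]
  exact Real.exp_le_exp.2 (by linarith)

variable {Ω : Type*} [mΩ : MeasurableSpace Ω] {P : Measure Ω} [IsProbabilityMeasure P]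

/-- The pull-out property. It exchanges events with equal conditional probabilities, such as playing
`a` and `a` being optimal. -/
lemma setIntegral_eq_integral_condExp_mul {m : MeasurableSpace Ω} (hm : m ≤ mΩ) {A : Set Ω}
    (hA : MeasurableSet[mΩ] A) {q G : Ω → ℝ} (hq : P⟦A | m⟧ =ᵐ[P] q) (hG : StronglyMeasurable[m] G)
    (hGi : Integrable G P) : ∫ ω in A, G ω ∂P = ∫ ω, q ω * G ω ∂P := by
  have h1 : Integrable (A.indicator fun _ => (1 : ℝ)) P := (integrable_const _).indicator hA
  have e : (A.indicator fun _ => (1 : ℝ)) * G = A.indicator G := by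
    ext ω; by_cases h : ω ∈ A <;> simp [h]
  have h2 := condExp_mul_of_stronglyMeasurable_right hG (μ := P) (m := m)
    (f := A.indicator fun _ => (1 : ℝ)) (by rw [e]; exact hGi.indicator hA) h1
  rw [← integral_indicator hA, ← e, ← integral_condExp hm, integral_congr_ae h2]
  refine integral_congr_ae ?_
  filter_upwards [hq] with ω hω
  simp [hω]

lemma exists_measurable_version_condProb {β : Type*} [MeasurableSpace β] {Z : Ω → β}
    (hZ : Measurable Z) {A : Set Ω} (hA : MeasurableSet A) :
    ∃ ψ : β → ℝ, Measurable ψ ∧ (∀ b, |ψ b| ≤ 1) ∧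
      P⟦A | sigmaOf Z⟧ =ᵐ[P] fun ω => ψ (Z ω) := by
  have hm : sigmaOf Z ≤ mΩ := hZ.comap_le
  obtain ⟨φ, hφ, hφe⟩ := (stronglyMeasurable_condExp (μ := P) (m := sigmaOf Z)
    (f := A.indicator fun _ => (1 : ℝ))).measurable.exists_eq_measurable_comp
  have h1 : Integrable (A.indicator fun _ => (1 : ℝ)) P := (integrable_const _).indicator hA
  -- Clamping to `[0, 1]` makes the bound hold everywhere and changes the version only on a null
  -- set.
  refine ⟨fun b => max 0 (min 1 (φ b)), by fun_prop, fun b => ?_, ?_⟩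
  · rw [abs_of_nonneg (le_max_left _ _)]
    exact max_le zero_le_one (min_le_left _ _)
  · have h0 : 0 ≤ᵐ[P] P⟦A | sigmaOf Z⟧ :=
      condExp_nonneg (.of_forall fun ω => Set.indicator_nonneg (by simp) ω)
    have h1 : P⟦A | sigmaOf Z⟧ ≤ᵐ[P] fun _ => (1 : ℝ) := by
      have := condExp_mono (m := sigmaOf Z) h1 (integrable_const (1 : ℝ))
        (.of_forall fun ω => Set.indicator_le_self' (fun _ _ => zero_le_one) ω)
      rwa [condExp_const hm] at this
    filter_upwards [h0, h1] with ω h0 h1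
    have e : (P⟦A | sigmaOf Z⟧) ω = φ (Z ω) := congrFun hφe ω
    rw [e] at h0 h1 ⊢
    replace h0 : 0 ≤ φ (Z ω) := h0
    rw [min_eq_right h1, max_eq_right h0]

variable {𝒳 : Type*} [Fintype 𝒳] [DecidableEq 𝒳] [MeasurableSpace 𝒳] [MeasurableSingletonClass 𝒳]

lemma integrable_apply_finite {f : Ω → 𝒳 → ℝ} (hf : ∀ a, Measurable fun ω => f ω a)
    (hfi : ∀ a, Integrable (fun ω => f ω a) P) {x : Ω → 𝒳} (hx : Measurable x) :
    Integrable (fun ω => f ω (x ω)) P := by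
  refine (integrable_finsetSum Finset.univ fun a _ => (hfi a).abs).mono'
    (measurable_apply_finite hf hx).aestronglyMeasurable (.of_forall fun ω => ?_)
  exact Finset.single_le_sum (f := fun a => |f ω a|) (fun a _ => abs_nonneg _) (Finset.mem_univ _)

lemma integral_apply_finite {f : Ω → 𝒳 → ℝ} (hf : ∀ a, Measurable fun ω => f ω a)
    (hfi : ∀ a, Integrable (fun ω => f ω a) P) {x : Ω → 𝒳} (hx : Measurable x) :
    ∫ ω, f ω (x ω) ∂P = ∑ a, ∫ ω in x ⁻¹' {a}, f ω a ∂P := by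
  have hi := integrable_apply_finite hf hfi hx
  have hfib := eq_sum_restrict_fiber (P := P) hx
  conv_lhs => rw [hfib]
  rw [integral_finsetSum_measure fun a _ => hi.restrict]
  refine Finset.sum_congr rfl fun a _ => ?_
  refine setIntegral_congr_fun (hx (measurableSet_singleton a)) fun ω hω => ?_
  have : x ω = a := hω
  simp only [this]

end Auxiliary

/-! ### Regret of a single round. -/

section Regret

variable {Ω : Type*} [mΩ : MeasurableSpace Ω] {P : Measure Ω} [IsProbabilityMeasure P]
  {𝒳 : Type*} [Fintype 𝒳] [DecidableEq 𝒳] [MeasurableSpace 𝒳] [MeasurableSingletonClass 𝒳]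
  {T : ℕ} {μ : EuclideanSpace ℝ 𝒳} {S : Matrix 𝒳 𝒳 ℝ} {s : Fin T → 𝒳 → ℝ≥0}

lemma integrable_eval_multivariateGaussian {K : Matrix 𝒳 𝒳 ℝ} (hK : K.PosSemidef) (a : 𝒳) :
    Integrable (fun z => z a) (multivariateGaussian μ K) := by
  have h := measurePreserving_eval_multivariateGaussian (μ := μ) hK (i := a)
  have hi : Integrable id (gaussianReal (μ a) (K a a).toNNReal) :=
    (memLp_id_gaussianReal 1).integrable (by simp)
  exact h.integrable_comp_of_integrable hi

lemma integral_comp_eval_multivariateGaussian {K : Matrix 𝒳 𝒳 ℝ} (hK : K.PosSemidef) (a : 𝒳)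
    {g : ℝ → ℝ} (hg : Measurable g) :
    ∫ z, g (z a) ∂(multivariateGaussian 0 K) = ∫ x, g x ∂(gaussianReal 0 (K a a).toNNReal) := by
  have h := measurePreserving_eval_multivariateGaussian (μ := 0) hK (i := a)
  have := integral_map (μ := multivariateGaussian 0 K) h.measurable.aemeasurable (f := g)
    hg.aestronglyMeasurable
  rw [h.map_eq] at this
  simpa using this.symm

/-- The actions contained in a history, completed by a fixed action. -/
def historyActions (a₀ : 𝒳) (t : Fin T) (h : Set.Iio t → 𝒳 × ℝ) : Fin T → 𝒳 :=
  fun i => if hi : i < t then (h ⟨i, hi⟩).1 else a₀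

@[fun_prop]
lemma measurable_historyActions (a₀ : 𝒳) (t : Fin T) : Measurable (historyActions a₀ t) := by
  refine measurable_pi_lambda _ fun i => ?_
  unfold historyActions
  split_ifs <;> fun_prop

lemma historyActions_history (a₀ : 𝒳) (x : Fin T → Ω → 𝒳) (y : Fin T → Ω → ℝ) (t : Fin T) (ω : Ω)
    (i : Fin T) (hi : (i : ℕ) < t) : historyActions a₀ t (history x y t ω) i = x i ω := by
  have : i < t := hi
  simp [historyActions, history, this]

lemma stronglyMeasurable_comp_sigmaOf {β : Type*} [MeasurableSpace β] {Z : Ω → β} {g : β → ℝ}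
    (hg : Measurable g) : StronglyMeasurable[sigmaOf Z] fun ω => g (Z ω) :=
  (hg.comp (comap_measurable Z)).stronglyMeasurable

lemma stronglyMeasurable_postMean_history [Nonempty 𝒳] (x : Fin T → Ω → 𝒳) (y : Fin T → Ω → ℝ)
    (n : Fin T) (a : 𝒳) : StronglyMeasurable[sigmaOf (history x y n)]
      fun ω => postMean μ S s (fun i => x i ω) (fun i => y i ω) n a := by
  obtain ⟨a₀⟩ := ‹Nonempty 𝒳›
  have hE : Measurable fun z : EuclideanSpace ℝ 𝒳 => z a := by fun_prop
  have hj : Measurable fun p : (Fin T → 𝒳) × (Fin T → ℝ) => postMean μ S s p.1 p.2 n a :=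
    measurable_from_prod_countable_right fun l => hE.comp (measurable_postMean l n)
  have hg : Measurable fun h : Set.Iio n → 𝒳 × ℝ =>
      postMean μ S s (historyActions a₀ n h) (historyObs n h) n a :=
    hj.comp (by fun_prop : Measurable fun h => (historyActions a₀ n h, historyObs n h))
  convert stronglyMeasurable_comp_sigmaOf (Z := history x y n) hg using 2 with ω
  rw [historyObs_history, postMean_trunc _ _ le_rfl]
  exact congrArg (fun z : EuclideanSpace ℝ 𝒳 => z a) (postMean_congr
    (fun i hi => (historyActions_history a₀ x y n ω i hi).symm) fun _ _ => rfl)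

lemma stronglyMeasurable_postCov_history [Nonempty 𝒳] (x : Fin T → Ω → 𝒳) (y : Fin T → Ω → ℝ)
    (n : Fin T) (a : 𝒳) : StronglyMeasurable[sigmaOf (history x y n)]
      fun ω => postCov S s (fun i => x i ω) n a a := by
  obtain ⟨a₀⟩ := ‹Nonempty 𝒳›
  have hj : Measurable fun l : Fin T → 𝒳 => postCov S s l n a a := .of_discrete
  convert stronglyMeasurable_comp_sigmaOf (Z := history x y n)
    (hj.comp (measurable_historyActions a₀ n)) using 2 with ω
  exact congrArg (fun K : Matrix 𝒳 𝒳 ℝ => K a a) (postCov_congr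
    (fun i hi => (historyActions_history a₀ x y n ω i hi).symm))

/-- The expected reward of the oracle action. -/
theorem integral_oracle_reward
    {rObs : Ω → EuclideanSpace ℝ 𝒳} (hrObs_meas : Measurable rObs)
    (hrObs : ∀ a, Integrable (fun ω => rObs ω a) P)
    {rHid : Ω → 𝒳 → ℝ} (hrHid_meas : Measurable rHid)
    (hrHid : ∀ a, Integrable (fun ω => rHid ω a) P) (hindep : IndepFun rObs rHid P)
    {B : 𝒳 → Set Ω} (hB : ∀ a, MeasurableSet (B a))
    {xObs : Ω → 𝒳} (hxObs_meas : Measurable xObs)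
    (hxObs : ∀ a : 𝒳, P⟦xObs ⁻¹' {a} | sigmaOf (fun ω => (rObs ω, rHid ω))⟧
        =ᵐ[P] P⟦B a | sigmaOf rObs⟧) :
    ∫ ω, (rObs ω (xObs ω) + rHid ω (xObs ω)) ∂P
      = ∑ a, (∫ ω in B a, rObs ω a ∂P + P.real (B a) * ∫ ω, rHid ω a ∂P) := by
  rw [integral_apply_finite (f := fun ω a => rObs ω a + rHid ω a) (fun a => by fun_prop)
    (fun a => (hrObs a).add (hrHid a)) hxObs_meas]
  refine Finset.sum_congr rfl fun a _ => ?_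
  obtain ⟨ψ, hψ, hψb, hψe⟩ := exists_measurable_version_condProb (P := P) hrObs_meas (hB a)
  have hA : MeasurableSet (xObs ⁻¹' {a}) := hxObs_meas (measurableSet_singleton a)
  have hm2 : sigmaOf (fun ω => (rObs ω, rHid ω)) ≤ mΩ :=
    (hrObs_meas.prodMk hrHid_meas).comap_le
  rw [integral_add (hrObs a).restrict (hrHid a).restrict]
  have g1 : Measurable fun p : EuclideanSpace ℝ 𝒳 × (𝒳 → ℝ) => p.1 a := by fun_prop
  have g2 : Measurable fun p : EuclideanSpace ℝ 𝒳 × (𝒳 → ℝ) => p.2 a := by fun_prop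
  have g3 : Measurable fun p : EuclideanSpace ℝ 𝒳 => p a := by fun_prop
  rw [setIntegral_eq_integral_condExp_mul hm2 hA ((hxObs a).trans hψe)
      (stronglyMeasurable_comp_sigmaOf (Z := fun ω => (rObs ω, rHid ω)) g1) (hrObs a),
    setIntegral_eq_integral_condExp_mul hm2 hA ((hxObs a).trans hψe)
      (stronglyMeasurable_comp_sigmaOf (Z := fun ω => (rObs ω, rHid ω)) g2) (hrHid a),
    setIntegral_eq_integral_condExp_mul hrObs_meas.comap_le (hB a) hψe
      (stronglyMeasurable_comp_sigmaOf (Z := rObs) g3) (hrObs a)]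
  congr 1
  -- The constant `G = 1` identifies `P (B a)` with the mean of `ψ (rObs)`, and independence then
  -- factors the hidden term.
  have hB1 := setIntegral_eq_integral_condExp_mul (G := fun _ => (1 : ℝ)) hrObs_meas.comap_le
    (hB a) hψe stronglyMeasurable_const (integrable_const _)
  simp only [mul_one, setIntegral_const, smul_eq_mul] at hB1
  have he : Measurable fun e : 𝒳 → ℝ => e a := measurable_pi_apply _
  rw [hB1]
  exact (hindep.comp hψ he).integral_fun_mul_eq_mul_integral
    (hψ.comp hrObs_meas).aestronglyMeasurable (he.comp hrHid_meas).aestronglyMeasurable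

/-- The one-round comparison: the regret against the oracle reduces to the posterior residual of the
observable reward at the optimal action, and the posterior variances of the chosen and of the
optimal action have the same mean. -/
theorem round_regret_le [Nonempty 𝒳]
    (hS : S.PosSemidef) (hs0 : ∀ n a, 0 < s n a)
    {rObs : Ω → EuclideanSpace ℝ 𝒳} (hrObs_meas : Measurable rObs)
    (hrObs : ∀ a, Integrable (fun ω => rObs ω a) P)
    {rHid : Ω → 𝒳 → ℝ} (hrHid_meas : Measurable rHid)
    (hrHid : ∀ a, Integrable (fun ω => rHid ω a) P) (hindep : IndepFun rObs rHid P)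
    {xStar : Ω → 𝒳} (hxStar : Measurable xStar)
    {xObs : Ω → 𝒳} (hxObs_meas : Measurable xObs)
    (hxObs : ∀ a : 𝒳, P⟦xObs ⁻¹' {a} | sigmaOf (fun ω => (rObs ω, rHid ω))⟧
        =ᵐ[P] P⟦xStar ⁻¹' {a} | sigmaOf rObs⟧)
    {x : Fin T → Ω → 𝒳} (hx_meas : ∀ n, Measurable (x n))
    {y : Fin T → Ω → ℝ} (hy_meas : ∀ n, Measurable (y n)) (n : Fin T)
    (hx : ∀ a : 𝒳, P⟦x n ⁻¹' {a} | sigmaOf (fun ω => (rObs ω, rHid ω, history x y n ω))⟧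
        =ᵐ[P] P⟦xStar ⁻¹' {a} | sigmaOf (history x y n)⟧)
    (hInv : ∀ l, ∃ ν : Measure (Fin T → ℝ), SFinite ν ∧
      (P.restrict (actionEvent x l n)).map (fun ω => (rObs ω - postMean μ S s l (fun i => y i ω) n,
          rHid ω, trunc n (fun i => y i ω)))
        = (multivariateGaussian 0 (postCov S s l n)).prod ((P.map rHid).prod ν))
    {c : ℝ} (hc : 0 < c) :
    ∫ ω, (rObs ω (xObs ω) + rHid ω (xObs ω)) ∂P - ∫ ω, (rObs ω (x n ω) + rHid ω (x n ω)) ∂P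
      ≤ (c * ∫ ω, postCov S s (fun i => x i ω) n (x n ω) (x n ω) ∂P
          + (2 * Real.log (2 * Fintype.card 𝒳) + 2) / c) / 2 := by
  have hHprob := Measure.isProbabilityMeasure_map (μ := P) hrHid_meas.aemeasurable
  have hist_m := measurable_history hx_meas hy_meas n
  set B : 𝒳 → Set Ω := fun a => xStar ⁻¹' {a}
  have hB : ∀ a, MeasurableSet (B a) := fun a => hxStar (measurableSet_singleton a)
  have hPSD := posSemidef_postCov (s := s) hS hs0
  set m : Ω → EuclideanSpace ℝ 𝒳 :=
    fun ω => postMean μ S s (fun i => x i ω) (fun i => y i ω) n with hm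
  set k : Ω → 𝒳 → ℝ := fun ω a => postCov S s (fun i => x i ω) n a a with hk
  have hk0 : ∀ ω a, 0 ≤ k ω a := fun ω a => (hPSD _ _).diag_nonneg
  have hkm : ∀ a, StronglyMeasurable[sigmaOf (history x y n)] fun ω => k ω a :=
    stronglyMeasurable_postCov_history x y n
  have hmm : ∀ a, StronglyMeasurable[sigmaOf (history x y n)] fun ω => m ω a :=
    stronglyMeasurable_postMean_history x y n
  have hσ1 : sigmaOf (history x y n) ≤ mΩ := hist_m.comap_le
  have hσ2 : sigmaOf (fun ω => (rObs ω, rHid ω, history x y n ω)) ≤ mΩ :=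
    (hrObs_meas.prodMk (hrHid_meas.prodMk hist_m)).comap_le
  have hσ12 : sigmaOf (history x y n) ≤ sigmaOf (fun ω => (rObs ω, rHid ω, history x y n ω)) := by
    have : history x y n = (fun p : EuclideanSpace ℝ 𝒳 × (𝒳 → ℝ) × (Set.Iio n → 𝒳 × ℝ) => p.2.2) ∘
      fun ω => (rObs ω, rHid ω, history x y n ω) := rfl
    conv_lhs => rw [this]
    unfold sigmaOf
    rw [← MeasurableSpace.comap_comp]
    exact MeasurableSpace.comap_mono (by fun_prop : Measurable fun p : EuclideanSpace ℝ 𝒳 ×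
      (𝒳 → ℝ) × (Set.Iio n → 𝒳 × ℝ) => p.2.2).comap_le
  have hki : ∀ a, Integrable (fun ω => k ω a) P := fun a =>
    Integrable.of_bound ((hkm a).mono hσ1).aestronglyMeasurable (S a a) (.of_forall fun ω => by
      rw [Real.norm_eq_abs, abs_of_nonneg (hk0 ω a)]
      exact postCov_diag_le _ _ _)
  -- the residual has conditional mean zero
  have hres : ∀ (a : 𝒳) {ψ : (Set.Iio n → 𝒳 × ℝ) → ℝ}, Measurable ψ → (∀ h, |ψ h| ≤ 1) →
      Integrable (fun ω => ψ (history x y n ω) * (rObs ω - m ω) a) P ∧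
        ∫ ω, ψ (history x y n ω) * (rObs ω - m ω) a ∂P = 0 := by
    intro a ψ hψ hψb
    have h := integral_history_mul_residual (μ := μ) (S := S) (s := s) hrObs_meas hrHid_meas
      hx_meas hy_meas n hInv (f := fun _ z _ => z a) (c := fun _ => 0) (fun _ => by fun_prop)
      (fun _ _ _ => rfl) (fun _ _ _ => rfl)
      (fun l => (integrable_eval_multivariateGaussian (hPSD l n) a).comp_fst _)
      (fun l => by
        rw [integral_fun_fst (fun z : EuclideanSpace ℝ 𝒳 => z a), probReal_univ, one_smul,
          integral_comp_eval_multivariateGaussian (hPSD l n) a (g := fun w => w) measurable_id]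
        simp) hψ hψb
    simpa using h
  have hhid : ∀ (a : 𝒳) {ψ : (Set.Iio n → 𝒳 × ℝ) → ℝ}, Measurable ψ → (∀ h, |ψ h| ≤ 1) →
        ∫ ω, ψ (history x y n ω) * rHid ω a ∂P
          = (∫ ω, ψ (history x y n ω) ∂P) * ∫ ω, rHid ω a ∂P := by
    intro a ψ hψ hψb
    have he : Measurable fun e : 𝒳 → ℝ => e a := measurable_pi_apply _
    have hi : Integrable (fun e : 𝒳 → ℝ => e a) (P.map rHid) :=
      (integrable_map_measure he.aestronglyMeasurable hrHid_meas.aemeasurable).2 (hrHid a)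
    have h := integral_history_mul_residual (μ := μ) (S := S) (s := s) hrObs_meas hrHid_meas
      hx_meas hy_meas n hInv (f := fun _ _ e => e a) (c := fun _ => ∫ ω, rHid ω a ∂P)
      (fun _ => by fun_prop) (fun _ _ _ => rfl) (fun _ _ _ => rfl)
      (fun l => hi.comp_snd _)
      (fun l => by
        rw [integral_fun_snd (fun e : 𝒳 → ℝ => e a), probReal_univ, one_smul,
          integral_map hrHid_meas.aemeasurable he.aestronglyMeasurable]) hψ hψb
    rw [h.2, integral_mul_const]
  have hresi : ∀ a, Integrable (fun ω => (rObs ω - m ω) a) P := fun a => by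
    simpa using (hres a (ψ := fun _ => 1) measurable_const (by simp)).1
  have hmi : ∀ a, Integrable (fun ω => m ω a) P := fun a => by
    refine ((hrObs a).sub (hresi a)).congr (.of_forall fun ω => ?_)
    simp
  -- the expected reward of the chosen action, and its expected posterior variance
  have hplay : ∫ ω, (rObs ω (x n ω) + rHid ω (x n ω)) ∂P
      = ∑ a, (∫ ω in B a, m ω a ∂P + P.real (B a) * ∫ ω, rHid ω a ∂P) := by
    rw [integral_apply_finite (f := fun ω a => rObs ω a + rHid ω a) (fun a => by fun_prop)
      (fun a => (hrObs a).add (hrHid a)) (hx_meas n)]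
    refine Finset.sum_congr rfl fun a _ => ?_
    obtain ⟨ψ, hψ, hψb, hψe⟩ := exists_measurable_version_condProb (P := P) hist_m (hB a)
    have hA : MeasurableSet (x n ⁻¹' {a}) := hx_meas n (measurableSet_singleton a)
    have g1 : Measurable fun p : EuclideanSpace ℝ 𝒳 × (𝒳 → ℝ) × (Set.Iio n → 𝒳 × ℝ) => p.1 a := by
      fun_prop
    have g2 : Measurable fun p : EuclideanSpace ℝ 𝒳 × (𝒳 → ℝ) × (Set.Iio n → 𝒳 × ℝ) => p.2.1 a := by
      fun_prop
    rw [integral_add (hrObs a).restrict (hrHid a).restrict,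
      setIntegral_eq_integral_condExp_mul hσ2 hA ((hx a).trans hψe)
        (stronglyMeasurable_comp_sigmaOf (Z := fun ω => (rObs ω, rHid ω, history x y n ω)) g1)
        (hrObs a),
      setIntegral_eq_integral_condExp_mul hσ2 hA ((hx a).trans hψe)
        (stronglyMeasurable_comp_sigmaOf (Z := fun ω => (rObs ω, rHid ω, history x y n ω)) g2)
        (hrHid a),
      setIntegral_eq_integral_condExp_mul hσ1 (hB a) hψe (hmm a) (hmi a), hhid a hψ hψb]
    have hB1 := setIntegral_eq_integral_condExp_mul (G := fun _ => (1 : ℝ)) hσ1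
      (hB a) hψe stronglyMeasurable_const (integrable_const _)
    simp only [mul_one, setIntegral_const, smul_eq_mul] at hB1
    rw [← hB1]
    congr 1
    have hψm : Integrable (fun ω => ψ (history x y n ω) * m ω a) P :=
      (hmi a).bdd_mul (c := 1) (hψ.comp hist_m).aestronglyMeasurable
        (.of_forall fun ω => hψb _)
    have h0 := hres a hψ hψb
    -- The residual is orthogonal to functions of the history, so only the posterior mean survives.
    have : (fun ω => ψ (history x y n ω) * rObs ω a)
        = fun ω => ψ (history x y n ω) * (rObs ω - m ω) a + ψ (history x y n ω) * m ω a := by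
      ext ω; simp; ring
    rw [this, integral_add h0.1 hψm, h0.2, zero_add]
  have hvar : ∫ ω, k ω (x n ω) ∂P = ∑ a, ∫ ω in B a, k ω a ∂P := by
    rw [integral_apply_finite (fun a => ((hkm a).mono hσ1).measurable) hki (hx_meas n)]
    refine Finset.sum_congr rfl fun a _ => ?_
    -- The posterior variance is a function of the history, so it can be integrated against the
    -- conditional probability of either event, and the two probabilities agree.
    rw [setIntegral_eq_integral_condExp_mul hσ2 (hx_meas n (measurableSet_singleton a)) (hx a)
        ((hkm a).mono hσ12) (hki a),
      setIntegral_eq_integral_condExp_mul hσ1 (hB a) .rfl (hkm a) (hki a)]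
  -- tails of the normalized residual
  have hcard : (1 : ℝ) ≤ Fintype.card 𝒳 := by exact_mod_cast Fintype.card_pos
  -- Chosen so that `4 exp (-t) * exp (t / 2) = 2 / N`; the union bound over `N` actions then costs
  -- exactly `2`.
  set t : ℝ := 2 * Real.log (2 * Fintype.card 𝒳) with ht
  have ht1 : 1 ≤ t := by
    have : Real.log 2 ≤ Real.log (2 * Fintype.card 𝒳) :=
      Real.log_le_log two_pos (by linarith)
    have := Real.log_two_gt_d9
    linarith
  have hcosh : ∀ a, Integrable (fun ω => Real.cosh (√t * ((rObs ω - m ω) a / √(k ω a)))) P ∧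
      ∫ ω, Real.cosh (√t * ((rObs ω - m ω) a / √(k ω a))) ∂P ≤ Real.exp (t / 2) := by
    intro a
    have hgm : ∀ v : ℝ, Measurable fun w : ℝ => Real.cosh (√t * (w / √v)) := fun v => by fun_prop
    have hg : ∀ l, Integrable (fun w => Real.cosh (√t * (w / √(postCov S s l n a a))))
        (gaussianReal 0 (postCov S s l n a a).toNNReal) ∧
        ∫ w, Real.cosh (√t * (w / √(postCov S s l n a a)))
          ∂(gaussianReal 0 (postCov S s l n a a).toNNReal) ≤ Real.exp (t / 2) := fun l => by
      have := integral_cosh_gaussianReal_le (√t) (postCov S s l n a a).toNNReal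
      rwa [Real.coe_toNNReal _ (hPSD l n).diag_nonneg, Real.sq_sqrt (by linarith)] at this
    have h := integral_history_mul_residual (μ := μ) (S := S) (s := s) hrObs_meas hrHid_meas
      hx_meas hy_meas n hInv
      (f := fun l z _ => Real.cosh (√t * (z a / √(postCov S s l n a a))))
      (c := fun l => ∫ w, Real.cosh (√t * (w / √(postCov S s l n a a)))
          ∂(gaussianReal 0 (postCov S s l n a a).toNNReal))
      (fun _ => by fun_prop) (fun l l' hl => by simp only [postCov_congr hl])
      (fun l l' hl => by simp only [postCov_congr hl])
      (fun l => Integrable.comp_fst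
        ((measurePreserving_eval_multivariateGaussian (μ := 0) (hPSD l n)
          (i := a)).integrable_comp_of_integrable (hg l).1) _)
      (fun l => by
        rw [integral_fun_fst (fun z : EuclideanSpace ℝ 𝒳 =>
            Real.cosh (√t * (z a / √(postCov S s l n a a)))), probReal_univ, one_smul,
          integral_comp_eval_multivariateGaussian (hPSD l n) a (hgm _)])
      (ψ := fun _ => 1) measurable_const (b := 1) (by simp)
    simp only [one_mul] at h
    refine ⟨h.1, h.2.trans_le ?_⟩
    refine (integral_mono_of_nonneg (.of_forall fun ω => integral_nonneg fun w =>
      (Real.cosh_pos _).le) (integrable_const _) (.of_forall fun ω => (hg _).2)).trans ?_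
    simp
  -- The normalized residual is `0` by convention where the variance vanishes, so recovering the
  -- residual from it requires the residual to vanish there almost surely.
  have hzero : ∀ a, ∀ᵐ ω ∂P, k ω a = 0 → (rObs ω - m ω) a = 0 := by
    intro a
    have hv : ∀ l, Integrable (fun w : ℝ => if postCov S s l n a a = 0 then w ^ 2 else 0)
        (gaussianReal 0 (postCov S s l n a a).toNNReal) ∧
        ∫ w : ℝ, (if postCov S s l n a a = 0 then w ^ 2 else 0)
          ∂(gaussianReal 0 (postCov S s l n a a).toNNReal) = 0 := fun l => by
      by_cases h : postCov S s l n a a = 0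
      · simp only [h, if_true]
        exact ⟨integrable_sq_gaussianReal _, by rw [integral_sq_gaussianReal]; simp⟩
      · simp [h]
    have hgm : ∀ v : ℝ, Measurable fun w : ℝ => if v = 0 then w ^ 2 else 0 := fun v => by
      split_ifs <;> fun_prop
    have h := integral_history_mul_residual (μ := μ) (S := S) (s := s) hrObs_meas hrHid_meas
      hx_meas hy_meas n hInv
      (f := fun l z _ => if postCov S s l n a a = 0 then z a ^ 2 else 0) (c := fun _ => 0)
      (fun l => by split_ifs <;> fun_prop) (fun l l' hl => by simp only [postCov_congr hl])
      (fun _ _ _ => rfl)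
      (fun l => Integrable.comp_fst
        ((measurePreserving_eval_multivariateGaussian (μ := 0) (hPSD l n)
          (i := a)).integrable_comp_of_integrable (hv l).1) _)
      (fun l => by
        rw [integral_fun_fst (fun z : EuclideanSpace ℝ 𝒳 =>
            if postCov S s l n a a = 0 then z a ^ 2 else 0), probReal_univ, one_smul,
          integral_comp_eval_multivariateGaussian (hPSD l n) a (hgm _), (hv l).2])
      (ψ := fun _ => 1) measurable_const (b := 1) (by simp)
    simp only [one_mul, integral_zero] at h
    have := (integral_eq_zero_iff_of_nonneg (fun ω => by
      simp only [Pi.zero_apply]; split_ifs <;> positivity) h.1).1 h.2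
    filter_upwards [this] with ω hω hkω
    simp only [Pi.zero_apply] at hω
    rw [if_pos hkω] at hω
    exact pow_eq_zero_iff two_ne_zero |>.1 hω
  have hpt : ∀ a, ∀ᵐ ω ∂P, (rObs ω - m ω) a ≤ (c * k ω a + (t + 4 * Real.exp (-t) *
      Real.cosh (√t * ((rObs ω - m ω) a / √(k ω a)))) / c) / 2 := by
    intro a
    filter_upwards [hzero a] with ω hω
    have h1 := sq_le_add_cosh ht1 ((rObs ω - m ω) a / √(k ω a))
    set Z := (rObs ω - m ω) a / √(k ω a) with hZ
    have h2 : (rObs ω - m ω) a = √(k ω a) * Z := by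
      rcases (hk0 ω a).eq_or_lt with h | h
      · rw [hω h.symm, ← h]; simp
      · rw [hZ, mul_div_cancel₀ _ (Real.sqrt_pos.2 h).ne']
    -- Weighted AM-GM; the difference of the two sides is a square.
    have h3 : √(k ω a) * Z ≤ (c * k ω a + Z ^ 2 / c) / 2 := by
      have h4 := Real.sq_sqrt (hk0 ω a)
      have h5 : (c * k ω a + Z ^ 2 / c) / 2 - √(k ω a) * Z = (c * √(k ω a) - Z) ^ 2 / (2 * c) := by
        rw [← h4, Real.sqrt_sq (Real.sqrt_nonneg _)]
        field_simp
        ring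
      have : 0 ≤ (c * √(k ω a) - Z) ^ 2 / (2 * c) := by positivity
      linarith
    rw [h2]
    refine h3.trans ?_
    gcongr
  -- assembling the pieces
  have hosub : ∫ ω, (rObs ω (xObs ω) + rHid ω (xObs ω)) ∂P
      - ∫ ω, (rObs ω (x n ω) + rHid ω (x n ω)) ∂P = ∑ a, ∫ ω in B a, (rObs ω - m ω) a ∂P := by
    rw [integral_oracle_reward hrObs_meas hrObs hrHid_meas hrHid hindep hB hxObs_meas hxObs, hplay,
      ← Finset.sum_sub_distrib]
    refine Finset.sum_congr rfl fun a _ => ?_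
    simp only [PiLp.sub_apply]
    rw [integral_sub (hrObs a).restrict (hmi a).restrict]
    ring
  have hterm : ∀ a, ∫ ω in B a, (rObs ω - m ω) a ∂P
      ≤ (c * ∫ ω in B a, k ω a ∂P + (t * P.real (B a) + 2 / Fintype.card 𝒳) / c) / 2 := by
    intro a
    have i1 := hki a
    have i2 := (hcosh a).1.const_mul (4 * Real.exp (-t))
    have i3 : Integrable (fun ω => (c * k ω a + (t + 4 * Real.exp (-t) *
      Real.cosh (√t * ((rObs ω - m ω) a / √(k ω a)))) / c) / 2) P :=
      ((i1.const_mul c).add (((integrable_const t).add i2).div_const c)).div_const 2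
    refine (integral_mono_ae (hresi a).restrict i3.restrict (ae_restrict_of_ae (hpt a))).trans ?_
    have j1 := (i1.const_mul c).restrict (s := B a)
    have j2 := i2.restrict (s := B a)
    have j0 : Integrable (fun _ : Ω => t) (P.restrict (B a)) := integrable_const t
    have j3 : Integrable (fun ω => (t + 4 * Real.exp (-t) *
      Real.cosh (√t * ((rObs ω - m ω) a / √(k ω a)))) / c) (P.restrict (B a)) :=
      (j0.add j2).div_const c
    rw [integral_div, integral_add j1 j3, integral_div,
      integral_add j0 j2, integral_const_mul, integral_const, smul_eq_mul,
      measureReal_restrict_apply .univ, Set.univ_inter, mul_comm (P.real _)]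
    -- Enlarging `B a` to the whole space removes the dependence between residual and optimal
    -- action. Only the nonnegative `cosh` term is enlarged; the term `t` keeps its weight `P (B
    -- a)`, and these weights sum to one.
    have hle : ∫ ω in B a, 4 * Real.exp (-t) * Real.cosh (√t * ((rObs ω - m ω) a / √(k ω a))) ∂P
        ≤ 2 / Fintype.card 𝒳 := by
      refine (setIntegral_le_integral i2 (.of_forall fun ω => ?_)).trans ?_
      · have := Real.cosh_pos (√t * ((rObs ω - m ω) a / √(k ω a)))
        have := Real.exp_pos (-t)
        simp only [Pi.zero_apply]
        positivity
      · rw [integral_const_mul]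
        calc _ ≤ 4 * Real.exp (-t) * Real.exp (t / 2) := by
              gcongr
              exact (hcosh a).2
          _ = 4 * Real.exp (-(t / 2)) := by
              rw [mul_assoc, ← Real.exp_add]; congr 2; ring
          _ = 2 / Fintype.card 𝒳 := by
              rw [ht, mul_div_cancel_left₀ _ two_ne_zero, Real.exp_neg,
                Real.exp_log (by linarith)]
              field_simp
              norm_num
    gcongr
  have hsumB : ∑ a, P.real (B a) = 1 := by
    have h := integral_apply_finite (P := P) (f := fun _ _ => 1) (fun _ => measurable_const)
      (fun _ => integrable_const _) hxStar
    simpa [setIntegral_const] using h.symm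
  rw [hosub, hvar]
  refine (Finset.sum_le_sum fun a _ => hterm a).trans (le_of_eq ?_)
  rw [← Finset.sum_div, Finset.sum_add_distrib, ← Finset.mul_sum, ← Finset.sum_div,
    Finset.sum_add_distrib, ← Finset.mul_sum, hsumB, Finset.sum_const, Finset.card_univ,
    nsmul_eq_mul, mul_div_cancel₀ _ (by linarith : (Fintype.card 𝒳 : ℝ) ≠ 0), mul_one]

end Regret

end ThompsonHidden

end

/-! ### Summation over the rounds. -/

theorem theorem3
    {Ω : Type*} [MeasurableSpace Ω] (P : Measure Ω) [IsProbabilityMeasure P]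
    {𝒳 : Type*} [Fintype 𝒳] [DecidableEq 𝒳] [MeasurableSpace 𝒳] [MeasurableSingletonClass 𝒳]
    (T : ℕ)
    -- the observable component: Gaussian with marginal variances at most one
    (μ : EuclideanSpace ℝ 𝒳) (S : Matrix 𝒳 𝒳 ℝ) (hS : S.PosSemidef) (hS1 : ∀ a, S a a ≤ 1)
    (rObs : Ω → EuclideanSpace ℝ 𝒳) (hrObs_meas : Measurable rObs)
    (hrObs : HasLaw rObs (multivariateGaussian μ S) P)
    -- the hidden component: finite mean, independent of the observable one
    (rHid : Ω → 𝒳 → ℝ) (hrHid_meas : Measurable rHid)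
    (hrHid : ∀ a, Integrable (fun ω => rHid ω a) P)
    (hindep : IndepFun rObs rHid P)
    -- the reward
    (r : Ω → 𝒳 → ℝ) (hr : ∀ ω a, r ω a = rObs ω a + rHid ω a)
    -- the optimal action, for any measurable rule `argmax` that selects a maximizer
    (argmax : (𝒳 → ℝ) → 𝒳) (hargmax_meas : Measurable argmax)
    (hargmax : ∀ (g : 𝒳 → ℝ) (a : 𝒳), g a ≤ g (argmax g))
    (xStar : Ω → 𝒳) (hxStar : ∀ ω, xStar ω = argmax (r ω))
    -- the oracle action, drawn from the law of `xStar` given `rObs`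
    (xObs : Ω → 𝒳) (hxObs_meas : Measurable xObs)
    (hxObs : ∀ a : 𝒳,
      P⟦xObs ⁻¹' {a} | ThompsonHidden.sigmaOf (fun ω => (rObs ω, rHid ω))⟧
        =ᵐ[P] P⟦xStar ⁻¹' {a} | ThompsonHidden.sigmaOf rObs⟧)
    -- the noise levels (they may depend on the round and on the action)
    (σ : ℝ≥0) (hσ : 0 < σ) (s : Fin T → 𝒳 → ℝ≥0)
    (hs0 : ∀ n a, 0 < s n a) (hs : ∀ n a, s n a ≤ σ)
    -- actions, noise and observations
    (x : Fin T → Ω → 𝒳) (hx_meas : ∀ n, Measurable (x n))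
    (η : Fin T → 𝒳 → Ω → ℝ) (hη_meas : ∀ n a, Measurable (η n a))
    (y : Fin T → Ω → ℝ) (hy : ∀ n ω, y n ω = rObs ω (x n ω) + η n (x n ω) ω)
    (hη : ∀ n a, HasLaw (η n a) (gaussianReal 0 (s n a ^ 2)) P)
    (hη_indep : ∀ n, IndepFun (fun ω a => η n a ω)
      (fun ω => (rObs ω, rHid ω, ThompsonHidden.history x y n ω, x n ω)) P)
    -- Thompson sampling: in round `n`, given the past, the action is drawn from the law of
    -- `xStar` given the history
    (hx : ∀ (n : Fin T) (a : 𝒳),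
      P⟦x n ⁻¹' {a} | ThompsonHidden.sigmaOf
          (fun ω => (rObs ω, rHid ω, ThompsonHidden.history x y n ω))⟧
        =ᵐ[P] P⟦xStar ⁻¹' {a} | ThompsonHidden.sigmaOf (ThompsonHidden.history x y n)⟧) :
    ThompsonHidden.maxInfoGain μ S s ≠ ∞ ∧
    Integrable (fun ω => ∑ n : Fin T, (r ω (xObs ω) - r ω (x n ω))) P ∧
    ∫ ω, ∑ n : Fin T, (r ω (xObs ω) - r ω (x n ω)) ∂P
      ≤ ThompsonHidden.betaConst (Fintype.card 𝒳) *
          Real.sqrt (ThompsonHidden.noiseConst σ * T *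
            (ThompsonHidden.maxInfoGain μ S s).toReal) := by
  have hΩ := P.nonempty_of_neZero
  have : Nonempty 𝒳 := ⟨xStar hΩ.some⟩
  have hy_meas : ∀ n, Measurable (y n) := fun n => by
    have h := ThompsonHidden.measurable_apply_finite (f := fun ω a => rObs ω a + η n a ω)
      (fun a => by have := hη_meas n a; fun_prop) (hx_meas n)
    have e : y n = fun ω => rObs ω (x n ω) + η n (x n ω) ω := funext (hy n)
    rwa [e]
  have hr_meas : Measurable r := measurable_pi_lambda _ fun a => by
    simp only [hr]; fun_prop
  have hxStar_meas : Measurable xStar := by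
    have e : xStar = fun ω => argmax (r ω) := funext hxStar
    rw [e]; exact hargmax_meas.comp hr_meas
  have hrObs_int : ∀ a, Integrable (fun ω => rObs ω a) P := fun a => by
    have h := ThompsonHidden.integrable_eval_multivariateGaussian (μ := μ) hS a
    rw [← hrObs.map_eq] at h
    exact (integrable_map_measure h.1 hrObs.aemeasurable).1 h
  have hr_int : ∀ {z : Ω → 𝒳}, Measurable z → Integrable (fun ω => r ω (z ω)) P := fun hz =>
    ThompsonHidden.integrable_apply_finite (fun a => by fun_prop)
      (fun a => by simp only [hr]; exact (hrObs_int a).add (hrHid a)) hz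
  have hkm : ∀ n : Fin T, Measurable fun ω =>
      ThompsonHidden.postCov S s (fun i => x i ω) n (x n ω) (x n ω) := fun n => by
    have h1 : Measurable fun l : Fin T → 𝒳 => ThompsonHidden.postCov S s l n (l n) (l n) :=
      .of_discrete
    exact h1.comp (measurable_pi_lambda _ hx_meas)
  have hki : ∀ n : Fin T, Integrable (fun ω =>
      ThompsonHidden.postCov S s (fun i => x i ω) n (x n ω) (x n ω)) P := fun n =>
    Integrable.of_bound (hkm n).aestronglyMeasurable 1 (.of_forall fun ω => by
      rw [Real.norm_eq_abs, abs_of_nonneg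
        (ThompsonHidden.posSemidef_postCov hS hs0 _ _).diag_nonneg]
      exact (ThompsonHidden.postCov_diag_le _ _ _).trans (hS1 _))
  have hdiff : ∀ n, Integrable (fun ω => r ω (xObs ω) - r ω (x n ω)) P := fun n =>
    (hr_int hxObs_meas).sub (hr_int (hx_meas n))
  refine ⟨ThompsonHidden.maxInfoGain_ne_top hS hs0, integrable_finsetSum _ fun n _ => hdiff n, ?_⟩
  set γ := (ThompsonHidden.maxInfoGain μ S s).toReal with hγ
  set A : ℝ := 2 * Real.log (2 * Fintype.card 𝒳) + 2 with hA
  have hcard : (1 : ℝ) ≤ Fintype.card 𝒳 := by exact_mod_cast Fintype.card_pos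
  have hA0 : 0 ≤ A := by
    have := Real.log_nonneg (by linarith : (1 : ℝ) ≤ 2 * Fintype.card 𝒳)
    linarith
  -- The variance bound holds for every fixed location sequence, hence pathwise at the realized
  -- actions.
  have hsum : ∫ ω, ∑ n : Fin T, ThompsonHidden.postCov S s (fun i => x i ω) n (x n ω) (x n ω) ∂P
      ≤ ThompsonHidden.noiseConst σ * γ := by
    refine (integral_mono (integrable_finsetSum _ fun n _ => hki n) (integrable_const _)
      fun ω => ThompsonHidden.sum_postCov_le (μ := μ) hS hS1 hs0 hs hσ (fun i => x i ω)).trans ?_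
    simp [hγ]
  have hG0 : 0 ≤ ThompsonHidden.noiseConst σ * γ :=
    le_trans (integral_nonneg fun ω => Finset.sum_nonneg fun n _ =>
      (ThompsonHidden.posSemidef_postCov hS hs0 _ _).diag_nonneg) hsum
  have hmain : ∫ ω, ∑ n : Fin T, (r ω (xObs ω) - r ω (x n ω)) ∂P
      ≤ √(ThompsonHidden.noiseConst σ * γ * (T * A)) := by
    -- The same `c` serves all rounds, so one optimization after summation suffices.
    refine ThompsonHidden.le_sqrt_of_forall_le hG0 (by positivity) fun c hc => ?_
    rw [integral_finsetSum _ fun n _ => hdiff n]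
    have hround : ∀ n : Fin T, ∫ ω, (r ω (xObs ω) - r ω (x n ω)) ∂P
        ≤ (c * ∫ ω, ThompsonHidden.postCov S s (fun i => x i ω) n (x n ω) (x n ω) ∂P
          + A / c) / 2 := fun n => by
      rw [integral_sub (hr_int hxObs_meas) (hr_int (hx_meas n))]
      simp only [hr]
      exact ThompsonHidden.round_regret_le hS hs0 hrObs_meas hrObs_int hrHid_meas hrHid hindep
        hxStar_meas hxObs_meas hxObs hx_meas hy_meas n (hx n)
        (fun l => ThompsonHidden.exists_map_residual_actionEvent hS hs0 hrObs_meas hrObs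
          hrHid_meas hindep hx_meas hη_meas hy_meas hy hη hη_indep hx l n.2.le) hc
    refine (Finset.sum_le_sum fun n _ => hround n).trans ?_
    rw [integral_finsetSum _ fun n _ => hki n] at hsum
    rw [← Finset.sum_div, Finset.sum_add_distrib, ← Finset.mul_sum, Finset.sum_const,
      Finset.card_univ, Fintype.card_fin, nsmul_eq_mul, mul_div_assoc]
    gcongr
  refine hmain.trans ?_
  have e : ThompsonHidden.noiseConst σ * γ * (T * A)
      = A * (ThompsonHidden.noiseConst σ * T * γ) := by ring
  rw [e, Real.sqrt_mul hA0, ThompsonHidden.betaConst]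
  -- The argument gives the factor `√A`, which is at most `β = 1 + √A`.
  exact mul_le_mul_of_nonneg_right (by linarith) (Real.sqrt_nonneg _)
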